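/- Let $Q$ be a discrete group acting properly and cocompactly, by cubical automorphisms, on a CAT(0) cube complex $X$. Say that a subgroup $H\leq Q$ is \emph{convex-cocompact in $X$} if there exists a nonempty $H$-invariant convex subcomplex $C\subseteq X$ such that the action of $H$ on $C$ is cocompact. Let $Q\curvearrowright T$ be a splitting of $Q$, that is, an action of $Q$ by automorphisms on a simplicial tree $T$ with at least one edge, without edge-inversions, and minimal (there is no proper nonempty $Q$-invariant subtree). If the $Q$-stabiliser of every edge of $T$ is convex-cocompact in $X$, then the $Q$-stabiliser of every vertex of $T$ is convex-cocompact in $X$. -/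

import Mathlib

open scoped Pointwise

/-- The face of the combinatorial cube `{0,1}ⁿ` obtained by fixing the coordinates in `I`
to be those of `b`. -/
def cubeFace {n : ℕ} (I : Set (Fin n)) (b : Fin n → Bool) : Set (Fin n → Bool) :=
  {x | ∀ i ∈ I, x i = b i}

/-- A cube complex with vertex set `V`: cubes are embedded, and two cubes are disjoint or meet
in a single common face. Each cube is recorded by its set of vertices. -/
structure CubeComplex (V : Type*) where
  /-- The vertex sets of the cubes. -/
  cubes : Set (Set V)
  singleton_mem : ∀ v : V, {v} ∈ cubes
  /-- Each cube is a copy of some `{0,1}ⁿ`, and the cubes contained in it are exactly the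
  images of the faces of `{0,1}ⁿ`. -/
  exists_chart : ∀ c ∈ cubes, ∃ (n : ℕ) (φ : (Fin n → Bool) → V),
    Function.Injective φ ∧ Set.range φ = c ∧
      ∀ d : Set V, d ⊆ c → (d ∈ cubes ↔ ∃ I b, d = φ '' cubeFace I b)
  inter_mem : ∀ c ∈ cubes, ∀ d ∈ cubes, (c ∩ d).Nonempty → c ∩ d ∈ cubes

namespace CubeComplex

variable {V : Type*}

/-- The 1-skeleton: vertices are adjacent when they are the two endpoints of a 1-cube. -/
def skeleton (X : CubeComplex V) : SimpleGraph V where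
  Adj x y := x ≠ y ∧ ({x, y} : Set V) ∈ X.cubes
  symm := ⟨fun x y h => ⟨h.1.symm, Set.pair_comm x y ▸ h.2⟩⟩
  loopless := ⟨fun _ h => h.1 rfl⟩

/-- The simplices (including the empty one) of the link of the vertex `v`. The vertices of the
link are the edges at `v`, recorded by their endpoints other than `v`; a set of such edges is a
simplex when it is the set of all edges at `v` of some cube containing `v`. -/
def link (X : CubeComplex V) (v : V) : Set (Set V) :=
  {S | ∃ c ∈ X.cubes, v ∈ c ∧ S = {a | a ∈ c ∧ X.skeleton.Adj v a}}

/-- The link of `v` is a flag complex: finitely many vertices of the link span a simplex as soon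
as they pairwise do. -/
def IsFlagLink (X : CubeComplex V) (v : V) : Prop :=
  ∀ S : Set V, S.Finite → (∀ a ∈ S, ∀ b ∈ S, ({a, b} : Set V) ∈ X.link v) → S ∈ X.link v

/-- Homotopy rel endpoints of edge paths: the congruence generated by removing backtracks and
by pushing a path of length two across a square. -/
inductive Homotopic (X : CubeComplex V) :
    ∀ {u v : V}, X.skeleton.Walk u v → X.skeleton.Walk u v → Prop
  | refl {u v : V} (p : X.skeleton.Walk u v) : Homotopic X p p
  | symm {u v : V} {p q : X.skeleton.Walk u v} : Homotopic X p q → Homotopic X q p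
  | trans {u v : V} {p q r : X.skeleton.Walk u v} :
      Homotopic X p q → Homotopic X q r → Homotopic X p r
  | cons {u v w : V} (h : X.skeleton.Adj u v) {p q : X.skeleton.Walk v w} :
      Homotopic X p q → Homotopic X (.cons h p) (.cons h q)
  | backtrack {u v w : V} (h : X.skeleton.Adj u v) (p : X.skeleton.Walk u w) :
      Homotopic X (.cons h (.cons h.symm p)) p
  | square {u a b v w : V} (c : Set V) (hc : c ∈ X.cubes) (hcard : c.ncard = 4)
      (hu : u ∈ c) (ha : a ∈ c) (hb : b ∈ c) (hv : v ∈ c)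
      (hua : X.skeleton.Adj u a) (hav : X.skeleton.Adj a v)
      (hub : X.skeleton.Adj u b) (hbv : X.skeleton.Adj b v) (p : X.skeleton.Walk v w) :
      Homotopic X (.cons hua (.cons hav p)) (.cons hub (.cons hbv p))

/-- A CAT(0) cube complex: a (nonempty) connected, simply connected cube complex all of whose
vertex links are flag complexes. -/
structure IsCAT0 (X : CubeComplex V) : Prop where
  connected : X.skeleton.Connected
  simplyConnected : ∀ (v : V) (p : X.skeleton.Walk v v), X.Homotopic p .nil
  flag : ∀ v : V, X.IsFlagLink v

/-- A subcomplex: a set of cubes closed under passing to faces. -/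
structure Subcomplex (X : CubeComplex V) where
  cubes : Set (Set V)
  subset : cubes ⊆ X.cubes
  face_mem : ∀ c ∈ cubes, ∀ d ∈ X.cubes, d ⊆ c → d ∈ cubes

/-- The vertex set of a subcomplex. -/
def Subcomplex.verts {X : CubeComplex V} (C : X.Subcomplex) : Set V :=
  {v | {v} ∈ C.cubes}

/-- A subcomplex of a CAT(0) cube complex is convex when it is full and every vertex on a
combinatorial geodesic between two of its vertices belongs to it. -/
structure Subcomplex.IsConvex {X : CubeComplex V} (C : X.Subcomplex) : Prop where
  full : ∀ c ∈ X.cubes, c ⊆ C.verts → c ∈ C.cubes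
  geodesic : ∀ x ∈ C.verts, ∀ y ∈ C.verts, ∀ z : V,
    X.skeleton.dist x z + X.skeleton.dist z y = X.skeleton.dist x y → z ∈ C.verts

/-- The action of `Q` on the vertex set of `X` defines a cocompact cubulation: `X` is a CAT(0)
cube complex and `Q` acts on it by cubical automorphisms, properly (a finite subcomplex meets
only finitely many of its translates) and cocompactly (the translates of some finite set of cubes
cover `X`). -/
structure IsCocompactCubulation (Q : Type*) [Group Q] [MulAction Q V] (X : CubeComplex V) :
    Prop where
  cat0 : X.IsCAT0
  smul_mem : ∀ (g : Q), ∀ c ∈ X.cubes, g • c ∈ X.cubes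
  proper : ∀ K : Set V, K.Finite → {g : Q | ((g • K) ∩ K).Nonempty}.Finite
  cocompact : ∃ K : Set (Set V), K.Finite ∧ K ⊆ X.cubes ∧
    ∀ c ∈ X.cubes, ∃ g : Q, ∃ k ∈ K, c = g • k

/-- The subgroup `H` is convex-cocompact in `X`: it preserves a nonempty convex subcomplex and
acts cocompactly on it. -/
def IsConvexCocompact {Q : Type*} [Group Q] [MulAction Q V] (X : CubeComplex V)
    (H : Subgroup Q) : Prop :=
  ∃ C : X.Subcomplex, C.cubes.Nonempty ∧ C.IsConvex ∧
    (∀ h ∈ H, ∀ c ∈ C.cubes, h • c ∈ C.cubes) ∧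
    ∃ K : Set (Set V), K.Finite ∧ K ⊆ C.cubes ∧
      ∀ c ∈ C.cubes, ∃ h ∈ H, ∃ k ∈ K, c = h • k

end CubeComplex

/-- The action of `Q` on the vertex set of `T` defines a splitting of `Q`: `T` is a simplicial
tree with at least one edge, and `Q` acts on it by automorphisms, without edge inversions and
minimally (there is no proper invariant subtree). -/
structure IsSplitting (Q : Type*) {W : Type*} [Group Q] [MulAction Q W] (T : SimpleGraph W) :
    Prop where
  isTree : T.IsTree
  exists_edge : ∃ a b, T.Adj a b
  smul_adj : ∀ (g : Q) (a b : W), T.Adj a b → T.Adj (g • a) (g • b)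
  no_inversion : ∀ (g : Q) (a b : W), T.Adj a b → ¬ (g • a = b ∧ g • b = a)
  minimal : ∀ S : Set W, S.Nonempty → (∀ (g : Q), ∀ a ∈ S, g • a ∈ S) →
    (T.induce S).Connected → S = Set.univ

/-!
The proof has two parts.

*Halfspaces.* The combinatorial geometry of a CAT(0) cube complex is developed from its definition.
Call two edge paths swap equivalent when they differ by pushing subpaths of length two across
squares. The flag condition gives the cube condition `IsCAT0.exists_cube`, and from it follows, by
induction on the length, that two swap equivalent paths with different last edges end in two sides
of a common square (`IsCAT0.lastSwap`). Hence edges act on the set of reduced path classes,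
by adding or cancelling a last edge (`step`), and this action is compatible with backtracks and
squares. Simple connectedness then shows that a reduced path is determined up to swaps by its
endpoints (`IsCAT0.swapEquiv_of_reduced`), so that the reduced paths are the geodesics. Consequently
the 1-skeleton is bipartite and satisfies the quadrangle condition (`IsCAT0.quadrangle`). These two
properties, together with the fact that distinct squares share at most an edge, make the set
`X.halfspace a b` of the vertices nearer to `a` than to `b` convex with convex complement, let
halfspaces separate points from convex sets, and show that every neighbourhood of a convex set lies
in a convex set at finite distance (`IsCAT0.exists_thickening`).

*The splitting.* Let `V₀` be a finite set of vertices whose translates contain all vertices and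
edges, and label each vertex `p` by the vertices `g • w` of `T` with `p ∈ g • V₀`. The points of `X`
at which the label passes across a given edge `wb` of `T` form finitely many orbits of the
stabiliser of this edge. They hence lie in a convex set `K b` on which the edge stabiliser acts
cofinitely (`exists_convex_crossing`). Consider the convex hull of an orbit of the stabiliser of
`w`, and a point `p` in it with a label other than `w`; let `wb` be the first edge of `T` from `w`
towards that label. If `p ∉ K b`, then some halfspace contains `K b` but not `p`. The orbit is not
contained in this halfspace, so a geodesic in its complement joins a point of the orbit to `p`. This
geodesic passes across `wb` without meeting `K b`, a contradiction (`mem_of_mem_hull`). So the hull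
is covered by the sets `K b` and the vertices labelled `w`. Since only finitely many orbits of edges
at `w` are crossed at all, the stabiliser of `w` acts cofinitely on the hull.
-/

/-! ### Cubes and squares -/

namespace CubeComplex

variable {V : Type*}

/-- The vertex of `{0,1}ⁿ` that differs from `x` exactly in the `i`-th coordinate. -/
def flipAt {n : ℕ} (x : Fin n → Bool) (i : Fin n) : Fin n → Bool :=
  Function.update x i (!x i)

theorem flipAt_same {n : ℕ} (x : Fin n → Bool) (i : Fin n) : flipAt x i i = !x i := by
  simp [flipAt]

theorem flipAt_of_ne {n : ℕ} (x : Fin n → Bool) {i j : Fin n} (h : j ≠ i) :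
    flipAt x i j = x j := by
  simp [flipAt, h]

theorem flipAt_ne {n : ℕ} (x : Fin n → Bool) (i : Fin n) : flipAt x i ≠ x := by
  intro h
  have := congrFun h i
  rw [flipAt_same] at this
  cases hx : x i <;> simp [hx] at this

theorem flipAt_inj {n : ℕ} {x : Fin n → Bool} {i j : Fin n} (h : flipAt x i = flipAt x j) :
    i = j := by
  by_contra hij
  have := congrFun h i
  rw [flipAt_same, flipAt_of_ne x hij] at this
  cases hx : x i <;> simp [hx] at this

theorem flipAt_comm {n : ℕ} (x : Fin n → Bool) (i j : Fin n) :
    flipAt (flipAt x i) j = flipAt (flipAt x j) i := by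
  rcases eq_or_ne i j with rfl | hij
  · rfl
  · funext k
    simp only [flipAt, Function.update_apply]
    split_ifs <;> simp_all

theorem flipAt_flipAt {n : ℕ} (x : Fin n → Bool) (i : Fin n) : flipAt (flipAt x i) i = x := by
  funext k
  simp only [flipAt, Function.update_apply]
  split_ifs <;> simp_all

theorem cubeFace_compl_singleton {n : ℕ} (x : Fin n → Bool) (i : Fin n) :
    cubeFace {i}ᶜ x = {x, flipAt x i} := by
  ext y
  simp only [cubeFace, Set.mem_compl_iff, Set.mem_singleton_iff, Set.mem_ofPred_eq,
    Set.mem_insert_iff]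
  constructor
  · intro h
    by_cases hy : y i = x i
    · left
      funext k
      by_cases hk : k = i
      · rw [hk, hy]
      · exact h k hk
    · right
      funext k
      by_cases hk : k = i
      · rw [hk, flipAt_same]
        cases hx : x i <;> simp_all
      · rw [flipAt_of_ne x hk]
        exact h k hk
  · rintro (rfl | rfl) k hk
    · rfl
    · exact flipAt_of_ne x hk

theorem cubeFace_compl_pair {n : ℕ} (x : Fin n → Bool) {i j : Fin n} (hij : i ≠ j) :
    cubeFace {i, j}ᶜ x = {x, flipAt x i, flipAt (flipAt x i) j, flipAt x j} := by
  ext y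
  simp only [cubeFace, Set.mem_compl_iff, Set.mem_singleton_iff, Set.mem_ofPred_eq,
    Set.mem_insert_iff, not_or]
  constructor
  · intro h
    have key : ∀ z : Fin n → Bool, (∀ k, k ≠ i → k ≠ j → z k = x k) → y i = z i → y j = z j →
        y = z := by
      intro z hz h1 h2
      funext k
      by_cases hk : k = i
      · rw [hk, h1]
      · by_cases hk' : k = j
        · rw [hk', h2]
        · rw [h k ⟨hk, hk'⟩, hz k hk hk']
    by_cases h1 : y i = x i <;> by_cases h2 : y j = x j
    · exact .inl (key x (fun _ _ _ => rfl) h1 h2)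
    · refine .inr (.inr (.inr (key _ (fun k _ hk => flipAt_of_ne x hk) ?_ ?_)))
      · rw [flipAt_of_ne x hij, h1]
      · rw [flipAt_same]; cases hx : x j <;> simp_all
    · refine .inr (.inl (key _ (fun k hk _ => flipAt_of_ne x hk) ?_ ?_))
      · rw [flipAt_same]; cases hx : x i <;> simp_all
      · rw [flipAt_of_ne x hij.symm, h2]
    · refine .inr (.inr (.inl (key _ (fun k hk hk' => ?_) ?_ ?_)))
      · rw [flipAt_of_ne _ hk', flipAt_of_ne x hk]
      · rw [flipAt_of_ne _ hij, flipAt_same]; cases hx : x i <;> simp_all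
      · rw [flipAt_same, flipAt_of_ne x hij.symm]; cases hx : x j <;> simp_all
  · rintro (rfl | rfl | rfl | rfl) k ⟨hk, hk'⟩
    · rfl
    · exact flipAt_of_ne x hk
    · rw [flipAt_of_ne _ hk', flipAt_of_ne x hk]
    · exact flipAt_of_ne x hk'

/-- A face of `{0,1}ⁿ` with at least three vertices has at least four: it leaves two coordinates
free. -/
theorem ncard_cubeFace_ne_three {n : ℕ} (I : Set (Fin n)) (b : Fin n → Bool) :
    (cubeFace I b).ncard ≠ 3 := by
  intro h
  obtain ⟨x, y, z, hxy, hxz, hyz, hs⟩ := Set.ncard_eq_three.1 h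
  have hx : x ∈ cubeFace I b := by rw [hs]; simp
  have hy : y ∈ cubeFace I b := by rw [hs]; simp
  have hz : z ∈ cubeFace I b := by rw [hs]; simp
  -- Flipping a free coordinate pairs off the vertices of a face, so their number is even.
  obtain ⟨i, hi⟩ := Function.ne_iff.1 hxy
  have hiI : i ∉ I := fun hmem => hi ((hx i hmem).trans (hy i hmem).symm)
  have hflip : ∀ v ∈ cubeFace I b, flipAt v i ∈ cubeFace I b := fun v hv k hk => by
    rw [flipAt_of_ne v (fun e : k = i => hiI (e ▸ hk))]
    exact hv k hk
  have h1 := hflip x hx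
  have h2 := hflip y hy
  have h3 := hflip z hz
  have e := flipAt_ne x i
  have e' := flipAt_ne y i
  have e'' := flipAt_ne z i
  have inv : ∀ v w, flipAt v i = w → flipAt w i = v := fun v w h => by
    rw [← h, flipAt_flipAt]
  rw [hs] at h1 h2 h3
  simp only [Set.mem_insert_iff, Set.mem_singleton_iff] at h1 h2 h3
  have := inv x; have := inv y; have := inv z
  rcases h1 with h1 | h1 | h1 <;> rcases h2 with h2 | h2 | h2 <;> rcases h3 with h3 | h3 | h3 <;>
    grind

variable {X : CubeComplex V}

theorem cube_nonempty {c : Set V} (hc : c ∈ X.cubes) : c.Nonempty := by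
  obtain ⟨n, φ, -, rfl, -⟩ := X.exists_chart c hc
  exact Set.range_nonempty φ

theorem cube_finite {c : Set V} (hc : c ∈ X.cubes) : c.Finite := by
  obtain ⟨n, φ, -, rfl, -⟩ := X.exists_chart c hc
  exact Set.finite_range φ

theorem ncard_cube_ne_three {c : Set V} (hc : c ∈ X.cubes) : c.ncard ≠ 3 := by
  obtain ⟨n, φ, hφ, hr, h⟩ := X.exists_chart c hc
  obtain ⟨I, b, hd⟩ := (h c subset_rfl).1 hc
  rw [hd, Set.ncard_image_of_injective _ hφ]
  exact ncard_cubeFace_ne_three I b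

/-- Within a cube, adjacency in the 1-skeleton is adjacency in `{0,1}ⁿ`. -/
theorem chart_adj_iff {c : Set V} {n : ℕ} {φ : (Fin n → Bool) → V} (hφ : Function.Injective φ)
    (hr : Set.range φ = c)
    (h : ∀ d : Set V, d ⊆ c → (d ∈ X.cubes ↔ ∃ I b, d = φ '' cubeFace I b))
    (x y : Fin n → Bool) : X.skeleton.Adj (φ x) (φ y) ↔ ∃ i, y = flipAt x i := by
  have hsub : ({φ x, φ y} : Set V) ⊆ c := by
    rw [← hr]; rintro _ (rfl | rfl) <;> exact Set.mem_range_self _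
  constructor
  · rintro ⟨hne, hc⟩
    obtain ⟨I, b, hd⟩ := (h _ hsub).1 hc
    rw [← Set.image_pair, hφ.image_injective.eq_iff] at hd
    have hxy : x ≠ y := fun e => hne (e ▸ rfl)
    obtain ⟨i, hi⟩ := Function.ne_iff.1 hxy
    have hx : x ∈ cubeFace I b := hd ▸ by simp
    have hy : y ∈ cubeFace I b := hd ▸ by simp
    have hmem : flipAt x i ∈ cubeFace I b := fun k hk => by
      have hki : k ≠ i := fun e => hi (by rw [← e, hx k hk, hy k hk])
      rw [flipAt_of_ne x hki]
      exact hx k hk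
    rw [← hd] at hmem
    rcases hmem with hmem | hmem
    · exact absurd hmem (flipAt_ne x i)
    · exact ⟨i, (Set.mem_singleton_iff.1 hmem).symm⟩
  · rintro ⟨i, rfl⟩
    refine ⟨fun e => flipAt_ne x i (hφ e).symm, (h _ hsub).2 ⟨{i}ᶜ, x, ?_⟩⟩
    rw [cubeFace_compl_singleton, Set.image_pair]

/-- `X.Square x y z y'`: the vertices `x, y, z, y'` are, in this cyclic order, the four distinct
corners of a 2-cube of `X`. -/
structure Square (X : CubeComplex V) (x y z y' : V) : Prop where
  adj₁ : X.skeleton.Adj x y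
  adj₂ : X.skeleton.Adj y z
  adj₃ : X.skeleton.Adj z y'
  adj₄ : X.skeleton.Adj y' x
  ne₁ : x ≠ z
  ne₂ : y ≠ y'
  mem : ({x, y, z, y'} : Set V) ∈ X.cubes

namespace Square

variable {x y z y' t : V}

theorem flip (h : X.Square x y z y') : X.Square x y' z y :=
  ⟨h.adj₄.symm, h.adj₃.symm, h.adj₂.symm, h.adj₁.symm, h.ne₁, h.ne₂.symm, by
    have : ({x, y', z, y} : Set V) = {x, y, z, y'} := by ext; simp; tauto
    rw [this]; exact h.mem⟩

theorem rot (h : X.Square x y z y') : X.Square y z y' x :=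
  ⟨h.adj₂, h.adj₃, h.adj₄, h.adj₁, h.ne₂, h.ne₁.symm, by
    have : ({y, z, y', x} : Set V) = {x, y, z, y'} := by ext; simp; tauto
    rw [this]; exact h.mem⟩

/-- Two squares with three common vertices agree, since they would otherwise meet in a set that
is not a face. -/
theorem unique (h : X.Square x y z y') (h' : X.Square x y t y') : z = t := by
  have hi := X.inter_mem _ h.mem _ h'.mem ⟨x, by simp⟩
  have h3 := ncard_cube_ne_three hi
  by_contra hzt
  have hz := h.ne₁; have hz₁ := h.adj₂.ne; have hz₂ := h.adj₃.ne
  apply h3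
  have : ({x, y, z, y'} ∩ {x, y, t, y'} : Set V) = {x, y, y'} := by
    ext v
    simp only [Set.mem_inter_iff, Set.mem_insert_iff, Set.mem_singleton_iff]
    constructor
    · rintro ⟨rfl | rfl | rfl | rfl, hv⟩ <;> grind
    · rintro (rfl | rfl | rfl) <;> simp
  rw [this, Set.ncard_eq_three]
  exact ⟨x, y, y', h.adj₁.ne, h.adj₄.ne', h.ne₂, rfl⟩

end Square

/-- Every cube with four elements is a square in the sense of `Square`. -/
theorem square_of_ncard {c : Set V} (hc : c ∈ X.cubes) (hcard : c.ncard = 4) {u a b v : V}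
    (hu : u ∈ c) (ha : a ∈ c) (hb : b ∈ c) (hv : v ∈ c)
    (hua : X.skeleton.Adj u a) (hav : X.skeleton.Adj a v)
    (hub : X.skeleton.Adj u b) (hbv : X.skeleton.Adj b v) (huv : u ≠ v) (hab : a ≠ b) :
    X.Square u a v b := by
  have hsub : ({u, a, v, b} : Set V) ⊆ c := by
    rintro _ (rfl | rfl | rfl | rfl) <;> assumption
  have hn : ({u, a, v, b} : Set V).ncard = 4 := by
    classical
    have := hua.ne; have := hav.ne; have := hub.ne; have := hbv.ne
    rw [Set.ncard_eq_toFinset_card', Set.toFinset_insert, Set.toFinset_insert,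
      Set.toFinset_insert, Set.toFinset_singleton]
    rw [Finset.card_insert_of_notMem, Finset.card_insert_of_notMem, Finset.card_insert_of_notMem,
      Finset.card_singleton] <;> simp <;> grind
  have := Set.eq_of_subset_of_ncard_le hsub (by rw [hn, hcard]) (cube_finite hc)
  exact ⟨hua, hav, hbv.symm, hub.symm, huv, hab, this ▸ hc⟩

theorem chart_square {c : Set V} {n : ℕ} {φ : (Fin n → Bool) → V} (hφ : Function.Injective φ)
    (hr : Set.range φ = c)
    (h : ∀ d : Set V, d ⊆ c → (d ∈ X.cubes ↔ ∃ I b, d = φ '' cubeFace I b))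
    (x : Fin n → Bool) {i j : Fin n} (hij : i ≠ j) :
    X.Square (φ x) (φ (flipAt x i)) (φ (flipAt (flipAt x i) j)) (φ (flipAt x j)) := by
  have hadj : ∀ x i, X.skeleton.Adj (φ x) (φ (flipAt x i)) := fun x i =>
    (chart_adj_iff hφ hr h _ _).2 ⟨i, rfl⟩
  refine ⟨hadj _ _, hadj _ _, ?_, (hadj _ _).symm, ?_, ?_, ?_⟩
  · rw [flipAt_comm]; exact (hadj _ _).symm
  · intro e
    have := congrFun (hφ e) i
    rw [flipAt_of_ne _ hij, flipAt_same] at this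
    cases hx : x i <;> simp [hx] at this
  · intro e
    exact hij (flipAt_inj (hφ e))
  · refine (h _ ?_).2 ⟨{i, j}ᶜ, x, ?_⟩
    · rw [← hr]; rintro _ (rfl | rfl | rfl | rfl) <;> exact Set.mem_range_self _
    · rw [cubeFace_compl_pair x hij]
      simp [Set.image_insert_eq]

theorem Square.pair_mem_link {x y z y' : V} (h : X.Square x y z y') :
    ({y, y'} : Set V) ∈ X.link x := by
  refine ⟨_, h.mem, by simp, ?_⟩
  ext a
  simp only [Set.mem_insert_iff, Set.mem_singleton_iff, Set.mem_ofPred_eq]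
  constructor
  · rintro (rfl | rfl)
    · exact ⟨by simp, h.adj₁⟩
    · exact ⟨by simp, h.adj₄.symm⟩
  · rintro ⟨rfl | rfl | rfl | rfl, ha⟩
    · exact absurd rfl ha.ne
    · exact .inl rfl
    · -- A diagonal is not an edge, because squares contain no triangles.
      exfalso
      obtain ⟨n, φ, hφ, hr, hch⟩ := X.exists_chart _ h.mem
      obtain ⟨p, rfl⟩ : x ∈ Set.range φ := by rw [hr]; simp
      obtain ⟨q, rfl⟩ : y ∈ Set.range φ := by rw [hr]; simp
      obtain ⟨r, rfl⟩ : a ∈ Set.range φ := by rw [hr]; simp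
      obtain ⟨i, rfl⟩ := (chart_adj_iff hφ hr hch _ _).1 h.adj₁
      obtain ⟨j, rfl⟩ := (chart_adj_iff hφ hr hch _ _).1 h.adj₂
      obtain ⟨k, hk⟩ := (chart_adj_iff hφ hr hch _ _).1 ha
      rcases eq_or_ne i j with rfl | hij
      · rw [flipAt_flipAt] at hk
        exact flipAt_ne _ _ hk.symm
      · have h1 := congrFun hk i
        have h2 := congrFun hk j
        rw [flipAt_of_ne _ hij, flipAt_same] at h1
        rw [flipAt_same, flipAt_of_ne _ hij.symm] at h2
        have hik : i = k := by
          by_contra hne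
          rw [flipAt_of_ne _ hne] at h1
          cases hx : p i <;> simp [hx] at h1
        have hjk : j = k := by
          by_contra hne
          rw [flipAt_of_ne _ hne] at h2
          cases hx : p j <;> simp [hx] at h2
        exact hij (hik.trans hjk.symm)
    · exact .inr rfl

theorem singleton_mem_link {x y : V} (h : X.skeleton.Adj x y) : ({y} : Set V) ∈ X.link x := by
  refine ⟨_, h.2, by simp, ?_⟩
  ext a
  simp only [Set.mem_insert_iff, Set.mem_singleton_iff, Set.mem_ofPred_eq]
  constructor
  · rintro rfl
    exact ⟨.inr rfl, h⟩
  · rintro ⟨rfl | rfl, ha⟩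
    · exact absurd rfl ha.ne
    · rfl

/-- The cube condition: three squares around the corner `v` that pairwise share an edge are
faces of a 3-cube, so that the three opposite faces exist and meet in a vertex. -/
theorem IsCAT0.exists_cube (hX : X.IsCAT0) {v a b c p q r : V} (hab : X.Square v a p b)
    (hbc : X.Square v b q c) (hac : X.Square v a r c) :
    ∃ t, X.Square a p t r ∧ X.Square b p t q ∧ X.Square c r t q := by
  have hflag := hX.flag v {a, b, c} (by simp) (by
    have h1 := hab.pair_mem_link; have h2 := hbc.pair_mem_link; have h3 := hac.pair_mem_link
    have e1 := singleton_mem_link hab.adj₁; have e2 := singleton_mem_link hbc.adj₁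
    have e3 := singleton_mem_link hac.adj₄.symm
    have := Set.pair_comm a b; have := Set.pair_comm b c; have := Set.pair_comm a c
    rintro _ (rfl | rfl | rfl) _ (rfl | rfl | rfl) <;> simp_all)
  obtain ⟨d, hd, hv, hS⟩ := hflag
  obtain ⟨n, φ, hφ, hr, hch⟩ := X.exists_chart _ hd
  have get : ∀ s ∈ ({a, b, c} : Set V), s ∈ Set.range φ ∧ X.skeleton.Adj v s := by
    intro s hs
    rw [hS] at hs
    rw [hr]
    exact hs
  rw [← hr] at hv
  obtain ⟨x, rfl⟩ := hv
  obtain ⟨⟨x₁, rfl⟩, ha⟩ := get a (by simp)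
  obtain ⟨⟨x₂, rfl⟩, hb⟩ := get b (by simp)
  obtain ⟨⟨x₃, rfl⟩, hc⟩ := get c (by simp)
  obtain ⟨i, rfl⟩ := (chart_adj_iff hφ hr hch _ _).1 ha
  obtain ⟨j, rfl⟩ := (chart_adj_iff hφ hr hch _ _).1 hb
  obtain ⟨k, rfl⟩ := (chart_adj_iff hφ hr hch _ _).1 hc
  have hij : i ≠ j := fun e => hab.ne₂ (by rw [e])
  have hjk : j ≠ k := fun e => hbc.ne₂ (by rw [e])
  have hik : i ≠ k := fun e => hac.ne₂ (by rw [e])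
  have sq : ∀ x {i j}, i ≠ j → X.Square (φ x) (φ (flipAt x i)) (φ (flipAt (flipAt x i) j))
    (φ (flipAt x j)) := fun x i j h => chart_square hφ hr hch x h
  obtain rfl := hab.unique (sq x hij)
  obtain rfl := hbc.unique (sq x hjk)
  obtain rfl := hac.unique (sq x hik)
  refine ⟨φ (flipAt (flipAt (flipAt x i) j) k), sq _ hjk, ?_, ?_⟩
  · rw [flipAt_comm x i j]
    exact sq _ hik
  · rw [flipAt_comm x i k, flipAt_comm (flipAt x i) j k, flipAt_comm x i k, flipAt_comm x j k]
    exact sq _ hij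

end CubeComplex

/-! ### Paths up to swaps -/

namespace CubeComplex

variable {V : Type*} {X : CubeComplex V}

/-- An elementary swap pushes two consecutive edges of a path across a square. A path is the list
of its vertices, from its endpoint back to its starting point. -/
inductive Swap (X : CubeComplex V) : List V → List V → Prop
  | head {x y z y' : V} (l : List V) (h : X.Square x y z y') :
      Swap X (x :: y :: z :: l) (x :: y' :: z :: l)
  | tail (x : V) {l l' : List V} (h : Swap X l l') : Swap X (x :: l) (x :: l')

/-- Two paths are swap equivalent when they differ by a sequence of elementary swaps. In contrast
with `Homotopic`, backtracks are not removed. -/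
def SwapEquiv (X : CubeComplex V) : List V → List V → Prop := Relation.EqvGen X.Swap

namespace SwapEquiv

variable {l l' l'' : List V}

theorem refl (l : List V) : X.SwapEquiv l l := Relation.EqvGen.refl l

theorem symm (h : X.SwapEquiv l l') : X.SwapEquiv l' l := Relation.EqvGen.symm _ _ h

theorem trans (h : X.SwapEquiv l l') (h' : X.SwapEquiv l' l'') : X.SwapEquiv l l'' :=
  Relation.EqvGen.trans _ _ _ h h'

theorem cons (x : V) (h : X.SwapEquiv l l') : X.SwapEquiv (x :: l) (x :: l') := by
  induction h with
  | rel _ _ h => exact .rel _ _ (.tail x h)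
  | refl => exact .refl _
  | symm _ _ _ ih => exact ih.symm
  | trans _ _ _ _ _ ih ih' => exact ih.trans ih'

theorem swap {x y z y' : V} (h : X.Square x y z y') (l : List V) :
    X.SwapEquiv (x :: y :: z :: l) (x :: y' :: z :: l) := .rel _ _ (.head l h)

theorem length_eq (h : X.SwapEquiv l l') : l.length = l'.length := by
  induction h with
  | rel _ _ h => induction h <;> simp_all
  | refl => rfl
  | symm _ _ _ ih => exact ih.symm
  | trans _ _ _ _ _ ih ih' => exact ih.trans ih'

theorem head_eq (h : X.SwapEquiv l l') : l.head? = l'.head? := by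
  induction h with
  | rel _ _ h => cases h <;> rfl
  | refl => rfl
  | symm _ _ _ ih => exact ih.symm
  | trans _ _ _ _ _ ih ih' => exact ih.trans ih'

theorem head_eq' {x x' : V} (h : X.SwapEquiv (x :: l) (x' :: l')) : x = x' := by
  simpa using h.head_eq

end SwapEquiv

/-- The paths `p` and `q`, both extended by an edge to `x`, differ by at most one swap that
involves the last edge. -/
def LastSwap (X : CubeComplex V) (x : V) (p q : List V) : Prop :=
  X.SwapEquiv p q ∨ ∃ y z y' l, X.Square x y z y' ∧ X.SwapEquiv p (y :: z :: l) ∧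
    X.SwapEquiv q (y' :: z :: l)

theorem LastSwap.symm {x : V} {p q : List V} (h : X.LastSwap x p q) : X.LastSwap x q p := by
  rcases h with h | ⟨y, z, y', l, hs, h, h'⟩
  · exact .inl h.symm
  · exact .inr ⟨y', z, y, l, hs.flip, h', h⟩

/-- Two swaps of the last edge in a row amount to at most one. The two squares, and the square
that the induction hypothesis `ih` provides on the middle path, surround a corner, and the cube
condition fills that corner. -/
theorem LastSwap.trans (hX : X.IsCAT0) {x : V} {p q r : List V}
    (ih : ∀ l : List V, l.length < q.length → ∀ y y' l', X.SwapEquiv (y :: l) (y' :: l') →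
      X.LastSwap y l l')
    (h : X.LastSwap x p q) (h' : X.LastSwap x q r) : X.LastSwap x p r := by
  rcases h with h | ⟨y₀, z₀, y₁, l₀, hs, hp, hq⟩
  · rcases h' with h' | ⟨y, z, y', l, hs', hq, hr⟩
    · exact .inl (h.trans h')
    · exact .inr ⟨y, z, y', l, hs', h.trans hq, hr⟩
  rcases h' with h' | ⟨y, z₁, y₂, l₁, hs', hq', hr⟩
  · exact .inr ⟨y₀, z₀, y₁, l₀, hs, hp, h'.symm.trans hq⟩
  have hqq := hq.symm.trans hq'
  obtain rfl := hqq.head_eq'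
  rcases ih (z₀ :: l₀) (by rw [hq.length_eq]; simp) _ _ _ hqq with hl | ⟨a, w, b, l, hs'', h₀, h₁⟩
  · obtain rfl := hl.head_eq'
    obtain rfl := hs.rot.rot.rot.unique hs'.rot.flip
    exact .inl (hp.trans ((hl.cons _).trans hr.symm))
  · obtain rfl := h₀.head_eq'
    obtain rfl := h₁.head_eq'
    obtain ⟨t, ht, ht₀, ht₁⟩ := hX.exists_cube hs.rot.rot.rot hs'' hs'.rot.flip
    exact .inr ⟨y₀, t, y₂, w :: l, ht,
      hp.trans ((h₀.cons y₀).trans (.swap ht₀.flip.rot.rot.rot l)),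
      hr.trans ((h₁.cons y₂).trans (.swap ht₁.flip.rot.rot.rot l))⟩

/-- Swap equivalent paths with a last edge differ by swaps of their initial parts and at most one
swap of the last two edges. -/
theorem IsCAT0.lastSwap (hX : X.IsCAT0) {x x' : V} {p q : List V}
    (h : X.SwapEquiv (x :: p) (x' :: q)) : X.LastSwap x p q := by
  induction hn : p.length using Nat.strong_induction_on generalizing x x' p q with
  | _ n ih =>
  have key : ∀ L L', X.SwapEquiv L L' → L.length = n + 1 →
      ∃ x p q, L = x :: p ∧ L' = x :: q ∧ X.LastSwap x p q := by
    intro L L' hL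
    induction hL with
    | rel L L' h =>
      intro _
      cases h with
      | head l hs => exact ⟨_, _, _, rfl, rfl, .inr ⟨_, _, _, l, hs, .refl _, .refl _⟩⟩
      | tail x h => exact ⟨_, _, _, rfl, rfl, .inl (.rel _ _ h)⟩
    | refl L =>
      intro hL
      obtain ⟨x, p, rfl⟩ := List.exists_cons_of_length_eq_add_one hL
      exact ⟨_, _, _, rfl, rfl, .inl (.refl _)⟩
    | symm L L' h ih' =>
      intro hL
      obtain ⟨x, p, q, rfl, rfl, h'⟩ := ih' ((SwapEquiv.length_eq h).trans hL)
      exact ⟨_, _, _, rfl, rfl, h'.symm⟩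
    | trans L L' L'' h h' ih₁ ih₂ =>
      intro hL
      have hL' : L'.length = n + 1 := (SwapEquiv.length_eq h).symm.trans hL
      obtain ⟨x, p, q, rfl, rfl, h₁⟩ := ih₁ hL
      obtain ⟨y, q', r, hq, rfl, h₂⟩ := ih₂ hL'
      obtain ⟨rfl, rfl⟩ := List.cons_eq_cons.1 hq
      refine ⟨_, _, _, rfl, rfl, h₁.trans hX (fun l hl y y' l' h => ?_) h₂⟩
      exact ih l.length (by simp at hL'; omega) h rfl
  obtain ⟨y, p', q', hp, hq, h'⟩ := key _ _ h (by simp [hn])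
  obtain ⟨rfl, rfl⟩ := List.cons_eq_cons.1 hp
  obtain ⟨rfl, rfl⟩ := List.cons_eq_cons.1 hq
  exact h'

/-- Cancellation of a common last edge. -/
theorem IsCAT0.cancel (hX : X.IsCAT0) {x x' y : V} {l l' : List V}
    (h : X.SwapEquiv (x :: y :: l) (x' :: y :: l')) : X.SwapEquiv (y :: l) (y :: l') := by
  rcases hX.lastSwap h with h | ⟨a, z, b, m, hs, h₁, h₂⟩
  · exact h
  · exact absurd (h₁.head_eq'.symm.trans h₂.head_eq') hs.ne₂

/-- If a path can end with either of two different edges `y → x` and `y' → x`, then these edges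
span a square, and the path can end by going around this square on either side. -/
theorem IsCAT0.exists_square (hX : X.IsCAT0) {x x' y y' : V} {l l' : List V}
    (h : X.SwapEquiv (x :: y :: l) (x' :: y' :: l')) (hy : y ≠ y') :
    ∃ z m, X.Square x y z y' ∧ X.SwapEquiv (y :: l) (y :: z :: m) ∧
      X.SwapEquiv (y' :: l') (y' :: z :: m) := by
  rcases hX.lastSwap h with h | ⟨a, z, b, m, hs, h₁, h₂⟩
  · exact absurd h.head_eq' hy
  · obtain rfl := h₁.head_eq'
    obtain rfl := h₂.head_eq'
    exact ⟨z, m, hs, h₁, h₂⟩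

/-- The path traverses some edge twice in a row, in opposite directions. -/
inductive Backtracks : List V → Prop
  | head (x y : V) (l : List V) : Backtracks (x :: y :: x :: l)
  | tail (x : V) {l : List V} (h : Backtracks l) : Backtracks (x :: l)

/-- A path is reduced when no path swap equivalent to it backtracks. -/
def Reduced (X : CubeComplex V) (l : List V) : Prop :=
  ∀ l', X.SwapEquiv l l' → ¬ Backtracks l'

namespace Reduced

theorem congr {l l' : List V} (h : X.Reduced l) (hl : X.SwapEquiv l l') : X.Reduced l' :=
  fun m hm => h m (hl.trans hm)

theorem of_cons {x : V} {l : List V} (h : X.Reduced (x :: l)) : X.Reduced l :=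
  fun _ hm hb => h _ (hm.cons x) (hb.tail x)

theorem not_equiv {x y : V} {l : List V} {m : List V} (h : X.Reduced l)
    (hl : X.SwapEquiv l (x :: y :: x :: m)) : False :=
  h _ hl (.head x y m)

theorem singleton (x : V) : X.Reduced [x] := by
  intro l hl hb
  have := hl.length_eq
  cases hb with
  | head => simp at this
  | tail _ h => cases h <;> simp at this

/-- Extending a reduced path by an edge gives a reduced path, unless the path could have ended
with the inverse of that edge. -/
theorem cons (hX : X.IsCAT0) {x y : V} {l : List V} (h : X.Reduced (x :: l))
    (hy : ∀ m, ¬ X.SwapEquiv (x :: l) (x :: y :: m)) : X.Reduced (y :: x :: l) := by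
  induction hn : l.length using Nat.strong_induction_on generalizing x y l with
  | _ n ih =>
  intro L hL hb
  cases hb with
  | head _ b m =>
    obtain rfl := hL.head_eq'
    by_cases hb : x = b
    · subst hb
      exact hy m (hX.cancel hL)
    obtain ⟨z, m', hs, h₁, h₂⟩ := hX.exists_square hL hb
    by_cases hz : y = z
    · exact hs.ne₁ hz
    obtain ⟨w, m'', hs', h₃, h₄⟩ := hX.exists_square h₂ hz
    -- By uniqueness of squares the fourth vertex `w` is `x`, so the path backtracks at `x`.
    obtain rfl := hs.rot.rot.rot.unique hs'
    exact h.not_equiv (h₁.trans (h₄.cons x))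
  | tail a hb' =>
    obtain rfl := hL.head_eq'
    rename_i m
    cases m with
    | nil => cases hb'
    | cons b m =>
    by_cases hxb : x = b
    · subst hxb
      exact h _ (hX.cancel hL) hb'
    obtain ⟨z, m', hs, h₁, h₂⟩ := hX.exists_square hL hxb
    have hlen := h₁.length_eq
    have hz : X.Reduced (z :: m') := (h.congr h₁).of_cons
    by_cases hd : ∃ k, X.SwapEquiv (z :: m') (z :: b :: k)
    · obtain ⟨k, hk⟩ := hd
      exact hy _ (h₁.trans ((hk.cons x).trans (.swap hs.rot k)))
    · refine ih m'.length (by simp at hlen; omega) hz (fun k hk => hd ⟨k, hk⟩) rfl _ h₂.symm hb'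

end Reduced

end CubeComplex

/-! ### Reduced paths and geodesics -/

namespace CubeComplex

variable {V : Type*} {X : CubeComplex V}

/-- Paths up to swap equivalence. -/
abbrev PathClass (X : CubeComplex V) : Type _ := Quot X.Swap

/-- The swap equivalence class of a path. -/
def cls (X : CubeComplex V) (l : List V) : X.PathClass := Quot.mk _ l

theorem cls_eq_iff {l l' : List V} : X.cls l = X.cls l' ↔ X.SwapEquiv l l' := Quot.eq

open Classical in
/-- Extending a path class by an edge to `y`: if the class contains a path whose last edge starts
at `y`, then that edge is removed, and otherwise an edge is added. -/
noncomputable def step (y : V) (α : X.PathClass) : X.PathClass :=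
  if h : ∃ x l, α = X.cls (x :: y :: l) then X.cls (y :: h.choose_spec.choose)
  else Quot.map (List.cons y) (fun _ _ h => .tail y h) α

theorem IsCAT0.step_cons_cons (hX : X.IsCAT0) (x y : V) (l : List V) :
    step y (X.cls (x :: y :: l)) = X.cls (y :: l) := by
  have h : ∃ x' l', X.cls (x :: y :: l) = X.cls (x' :: y :: l') := ⟨x, l, rfl⟩
  rw [step, dif_pos h, cls_eq_iff]
  exact (hX.cancel (cls_eq_iff.1 h.choose_spec.choose_spec)).symm

theorem step_of_not {x y : V} {l : List V} (h : ∀ m, ¬ X.SwapEquiv (x :: l) (x :: y :: m)) :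
    step y (X.cls (x :: l)) = X.cls (y :: x :: l) := by
  rw [step, dif_neg]
  · rfl
  · rintro ⟨x', m, hm⟩
    rw [cls_eq_iff] at hm
    obtain rfl := hm.head_eq'
    exact h m hm

/-- The path class consists of reduced paths ending at `x`. -/
def IsOver (x : V) (α : X.PathClass) : Prop :=
  ∃ l, X.Reduced (x :: l) ∧ α = X.cls (x :: l)

theorem IsOver.step (hX : X.IsCAT0) {x : V} {α : X.PathClass} (h : IsOver x α) (y : V) :
    IsOver y (step y α) := by
  obtain ⟨l, hl, rfl⟩ := h
  by_cases hd : ∃ m, X.SwapEquiv (x :: l) (x :: y :: m)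
  · obtain ⟨m, hm⟩ := hd
    rw [cls_eq_iff.2 hm, hX.step_cons_cons]
    exact ⟨m, (hl.congr hm).of_cons, rfl⟩
  · push Not at hd
    rw [step_of_not hd]
    exact ⟨_, hl.cons hX hd, rfl⟩

theorem IsCAT0.step_step (hX : X.IsCAT0) {x : V} {α : X.PathClass} (h : IsOver x α) (y : V) :
    step x (step y α) = α := by
  obtain ⟨l, hl, rfl⟩ := h
  by_cases hd : ∃ m, X.SwapEquiv (x :: l) (x :: y :: m)
  · obtain ⟨m, hm⟩ := hd
    rw [cls_eq_iff.2 hm, hX.step_cons_cons, step_of_not]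
    intro k hk
    exact hl.not_equiv (hm.trans (hk.cons x))
  · push Not at hd
    rw [step_of_not hd, hX.step_cons_cons]

/-- Following the two sides of a square extends a class in the same way, if the first side
removes an edge and the second one adds an edge. -/
theorem IsCAT0.step_square_aux (hX : X.IsCAT0) {x a y b : V} {l : List V}
    (hs : X.Square x a y b) (hl : X.Reduced (x :: a :: l))
    (hb : ∀ m, ¬ X.SwapEquiv (x :: a :: l) (x :: b :: m)) :
    step y (step a (X.cls (x :: a :: l))) = step y (step b (X.cls (x :: a :: l))) := by
  have hred := hl.cons hX hb
  have heq : X.SwapEquiv (b :: x :: a :: l) (b :: y :: a :: l) :=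
    .swap hs.rot.rot.rot l
  rw [hX.step_cons_cons, step_of_not hb, cls_eq_iff.2 heq, hX.step_cons_cons, step_of_not]
  intro m hm
  exact (hred.congr heq).of_cons.not_equiv (hm.cons y)

theorem IsCAT0.step_square (hX : X.IsCAT0) {x a y b : V} {α : X.PathClass} (h : IsOver x α)
    (hs : X.Square x a y b) : step y (step a α) = step y (step b α) := by
  obtain ⟨l, hl, rfl⟩ := h
  by_cases ha : ∃ m, X.SwapEquiv (x :: l) (x :: a :: m)
  · obtain ⟨m, hm⟩ := ha
    by_cases hb : ∃ m, X.SwapEquiv (x :: l) (x :: b :: m)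
    · obtain ⟨m', hm'⟩ := hb
      obtain ⟨z, k, hs', h₁, h₂⟩ := hX.exists_square (hm.symm.trans hm') hs.ne₂
      obtain rfl := hs.unique hs'
      rw [cls_eq_iff.2 hm, hX.step_cons_cons, cls_eq_iff.2 h₁, hX.step_cons_cons,
        ← cls_eq_iff.2 hm, cls_eq_iff.2 hm', hX.step_cons_cons, cls_eq_iff.2 h₂,
        hX.step_cons_cons]
    · push Not at hb
      rw [cls_eq_iff.2 hm]
      exact hX.step_square_aux hs (hl.congr hm) fun k hk => hb k (hm.trans hk)
  · by_cases hb : ∃ m, X.SwapEquiv (x :: l) (x :: b :: m)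
    · obtain ⟨m, hm⟩ := hb
      push Not at ha
      rw [cls_eq_iff.2 hm]
      exact (hX.step_square_aux hs.flip (hl.congr hm) fun k hk => ha k (hm.trans hk)).symm
    · push Not at ha hb
      have aux : ∀ {a b}, X.Square x a y b → (∀ m, ¬ X.SwapEquiv (x :: l) (x :: b :: m)) →
          ∀ m, ¬ X.SwapEquiv (a :: x :: l) (a :: y :: m) := by
        intro a b hs hb m hm
        obtain ⟨w, k, hs', h₁, -⟩ := hX.exists_square hm hs.ne₁
        obtain rfl := hs.flip.rot.rot.rot.unique hs'
        exact hb _ h₁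
      rw [step_of_not ha, step_of_not hb, step_of_not (aux hs hb), step_of_not (aux hs.flip ha),
        cls_eq_iff]
      exact .swap hs.rot.rot.flip l

/-- Extending a path class along a walk. -/
noncomputable def act : ∀ {u v : V}, X.skeleton.Walk u v → X.PathClass → X.PathClass
  | _, _, .nil, α => α
  | _, _, .cons (v := v) _ p, α => act p (step v α)

theorem act_append {u v w : V} (p : X.skeleton.Walk u v) (q : X.skeleton.Walk v w)
    (α : X.PathClass) : act (p.append q) α = act q (act p α) := by
  induction p generalizing α with
  | nil => rfl
  | cons h p ih => exact ih q _

theorem IsOver.act (hX : X.IsCAT0) {u v : V} (p : X.skeleton.Walk u v) {α : X.PathClass}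
    (h : IsOver u α) : IsOver v (act p α) := by
  induction p generalizing α with
  | nil => exact h
  | cons _ p ih => exact ih (h.step hX _)

theorem IsCAT0.act_reverse (hX : X.IsCAT0) {u v : V} (p : X.skeleton.Walk u v)
    {α : X.PathClass} (h : IsOver u α) : act p.reverse (act p α) = α := by
  induction p generalizing α with
  | nil => rfl
  | cons _ p ih =>
    rw [SimpleGraph.Walk.reverse_cons, act_append]
    change step _ (CubeComplex.act p.reverse (CubeComplex.act p _)) = α
    rw [ih (h.step hX _), hX.step_step h]

theorem IsCAT0.act_eq_of_homotopic (hX : X.IsCAT0) {u v : V} {p q : X.skeleton.Walk u v}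
    (hpq : X.Homotopic p q) {α : X.PathClass} (h : IsOver u α) : act p α = act q α := by
  induction hpq generalizing α with
  | refl => rfl
  | symm _ ih => exact (ih h).symm
  | trans _ _ ih ih' => exact (ih h).trans (ih' h)
  | cons _ _ ih => exact ih (h.step hX _)
  | @backtrack u v w _ p =>
    change CubeComplex.act p (step u (step v α)) = _
    rw [hX.step_step h]
  | @square u a b v w c hc hcard hu ha hb hv hua hav hub hbv p =>
    change CubeComplex.act p (step v (step a α)) = CubeComplex.act p (step v (step b α))
    rcases eq_or_ne a b with rfl | hab
    · rfl
    rcases eq_or_ne u v with rfl | huv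
    · rw [hX.step_step h, hX.step_step h]
    · rw [hX.step_square h (square_of_ncard hc hcard hu ha hb hv hua hav hub hbv huv hab)]

/-- Since the complex is simply connected, the reduced class obtained by following a walk depends only on
the endpoints of the walk. -/
theorem IsCAT0.act_eq (hX : X.IsCAT0) {u v : V} (p q : X.skeleton.Walk u v) {α : X.PathClass}
    (h : IsOver u α) : act p α = act q α := by
  have h₁ := hX.act_eq_of_homotopic (hX.simplyConnected u (p.append q.reverse)) h
  rw [act_append] at h₁
  have h₂ := hX.act_reverse q.reverse (h.act hX p)
  rw [SimpleGraph.Walk.reverse_reverse, h₁] at h₂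
  exact h₂.symm

/-- A list of vertices that is an edge path starting at `o` (the last entry of the list). -/
inductive IsPathFrom (X : CubeComplex V) (o : V) : List V → Prop
  | base : IsPathFrom X o [o]
  | cons {x y : V} {l : List V} (h : X.skeleton.Adj x y) (hl : IsPathFrom X o (y :: l)) :
      IsPathFrom X o (x :: y :: l)

namespace IsPathFrom

variable {o : V}

theorem swap {l l' : List V} (h : X.Swap l l') : X.IsPathFrom o l ↔ X.IsPathFrom o l' := by
  induction h with
  | head l hs =>
    constructor <;> rintro (_ | ⟨_, _ | ⟨_, h⟩⟩)
    · exact .cons hs.adj₄.symm (.cons hs.adj₃.symm h)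
    · exact .cons hs.adj₁ (.cons hs.adj₂ h)
  | tail x h ih =>
    cases h with
    | head =>
      constructor <;> rintro (_ | ⟨h, hl⟩)
      · exact .cons h (ih.1 hl)
      · exact .cons h (ih.2 hl)
    | tail =>
      constructor <;> rintro (_ | ⟨h, hl⟩)
      · exact .cons h (ih.1 hl)
      · exact .cons h (ih.2 hl)

theorem congr {l l' : List V} (h : X.SwapEquiv l l') :
    X.IsPathFrom o l ↔ X.IsPathFrom o l' := by
  induction h with
  | rel _ _ h => exact swap h
  | refl => rfl
  | symm _ _ _ ih => exact ih.symm
  | trans _ _ _ _ _ ih ih' => exact ih.trans ih'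

theorem exists_walk {x : V} {l : List V} (h : X.IsPathFrom o (x :: l)) :
    ∃ p : X.skeleton.Walk o x, p.length = l.length := by
  induction l generalizing x with
  | nil => cases h; exact ⟨.nil, rfl⟩
  | cons y l ih =>
    rcases h with _ | ⟨h, hl⟩
    obtain ⟨p, hp⟩ := ih hl
    exact ⟨p.concat h.symm, by simp [hp]⟩

theorem of_walk {x y : V} {l : List V} (h : X.IsPathFrom o (x :: l)) (p : X.skeleton.Walk x y) :
    ∃ l', X.IsPathFrom o (y :: l') ∧ l'.length = l.length + p.length := by
  induction p generalizing l with
  | nil => exact ⟨l, h, rfl⟩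
  | cons hadj p ih =>
    obtain ⟨l', h', hl'⟩ := ih (.cons hadj.symm h)
    exact ⟨l', h', by simp [hl']; omega⟩

/-- A backtracking path can be shortened. -/
theorem shorten {x : V} {l : List V} (h : X.IsPathFrom o (x :: l)) (hb : Backtracks (x :: l)) :
    ∃ l', X.IsPathFrom o (x :: l') ∧ l'.length < l.length := by
  induction l generalizing x with
  | nil => exact absurd hb fun | .tail _ h => nomatch h
  | cons y l ih =>
    rcases h with _ | ⟨hxy, h⟩
    rcases hb with ⟨_, _, l⟩ | ⟨_, hb⟩
    · rcases h with _ | ⟨_, h⟩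
      exact ⟨_, h, by simp⟩
    · obtain ⟨l', h', hl'⟩ := ih h hb
      exact ⟨y :: l', .cons hxy h', by simpa using hl'⟩

theorem dist_le {x : V} {l : List V} (h : X.IsPathFrom o (x :: l)) :
    X.skeleton.dist o x ≤ l.length := by
  obtain ⟨p, hp⟩ := h.exists_walk
  exact hp ▸ SimpleGraph.dist_le p

theorem reduced_of_length {x : V} {l : List V} (h : X.IsPathFrom o (x :: l))
    (hd : l.length = X.skeleton.dist o x) : X.Reduced (x :: l) := by
  intro m hm hb
  cases m with
  | nil => cases hb
  | cons y m =>
    obtain rfl := hm.head_eq'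
    obtain ⟨m', h', hlen⟩ := ((congr hm).1 h).shorten hb
    have := h'.dist_le
    have := hm.length_eq
    simp at this
    omega

end IsPathFrom

theorem exists_act_eq {o x : V} {l : List V}
    (h : X.IsPathFrom o (x :: l)) (hr : X.Reduced (x :: l)) :
    ∃ p : X.skeleton.Walk o x, act p (X.cls [o]) = X.cls (x :: l) := by
  induction l generalizing x with
  | nil => cases h; exact ⟨.nil, rfl⟩
  | cons y l ih =>
    rcases h with _ | ⟨hxy, h⟩
    obtain ⟨p, hp⟩ := ih h hr.of_cons
    refine ⟨p.append (.cons hxy.symm .nil), ?_⟩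
    rw [act_append, hp]
    exact step_of_not fun m hm => hr.not_equiv (hm.cons x)

/-- Two reduced paths with the same endpoints differ by swaps. -/
theorem IsCAT0.swapEquiv_of_reduced (hX : X.IsCAT0) {o x : V} {l l' : List V}
    (h : X.IsPathFrom o (x :: l)) (hr : X.Reduced (x :: l))
    (h' : X.IsPathFrom o (x :: l')) (hr' : X.Reduced (x :: l')) :
    X.SwapEquiv (x :: l) (x :: l') := by
  obtain ⟨p, hp⟩ := exists_act_eq h hr
  obtain ⟨q, hq⟩ := exists_act_eq h' hr'
  rw [← cls_eq_iff, ← hp, ← hq]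
  exact hX.act_eq p q ⟨[], .singleton o, rfl⟩

theorem IsCAT0.exists_geodesic (hX : X.IsCAT0) (o x : V) :
    ∃ l, X.IsPathFrom o (x :: l) ∧ l.length = X.skeleton.dist o x := by
  obtain ⟨p, hp⟩ := hX.connected.exists_walk_length_eq_dist o x
  obtain ⟨l, h, hl⟩ := IsPathFrom.of_walk .base p
  exact ⟨l, h, by simpa [hp] using hl⟩

theorem IsCAT0.length_of_reduced (hX : X.IsCAT0) {o x : V} {l : List V}
    (h : X.IsPathFrom o (x :: l)) (hr : X.Reduced (x :: l)) :
    l.length = X.skeleton.dist o x := by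
  obtain ⟨l', h', hl'⟩ := hX.exists_geodesic o x
  have := (hX.swapEquiv_of_reduced h hr h' (h'.reduced_of_length hl')).length_eq
  simp at this
  omega

/-- The 1-skeleton is bipartite. -/
theorem IsCAT0.dist_ne_of_adj (hX : X.IsCAT0) (o : V) {x y : V} (h : X.skeleton.Adj x y) :
    X.skeleton.dist o x ≠ X.skeleton.dist o y := by
  obtain ⟨l, hl, hlen⟩ := hX.exists_geodesic o x
  have hr := hl.reduced_of_length hlen
  by_cases hd : ∃ m, X.SwapEquiv (x :: l) (x :: y :: m)
  · obtain ⟨m, hm⟩ := hd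
    have h₁ := hm.length_eq
    rcases (IsPathFrom.congr hm).1 hl with _ | ⟨_, hm'⟩
    have := hX.length_of_reduced hm' (hr.congr hm).of_cons
    simp at h₁
    omega
  · push Not at hd
    have := hX.length_of_reduced (.cons h.symm hl) (hr.cons hX hd)
    simp at this
    omega

/-- The quadrangle condition: if two neighbours of `z` are nearer to `o` than `z` is, then they
span a square with `z` whose fourth corner is nearer still. -/
theorem IsCAT0.quadrangle (hX : X.IsCAT0) {o x y z : V} (hzx : X.skeleton.Adj z x)
    (hzy : X.skeleton.Adj z y) (hxy : x ≠ y)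
    (hx : X.skeleton.dist o z = X.skeleton.dist o x + 1)
    (hy : X.skeleton.dist o z = X.skeleton.dist o y + 1) :
    ∃ t, X.Square z x t y ∧ X.skeleton.dist o x = X.skeleton.dist o t + 1 := by
  obtain ⟨l, hl, hlen⟩ := hX.exists_geodesic o x
  obtain ⟨l', hl', hlen'⟩ := hX.exists_geodesic o y
  have h₁ := IsPathFrom.cons hzx hl
  have h₂ := IsPathFrom.cons hzy hl'
  have heq := hX.swapEquiv_of_reduced h₁ (h₁.reduced_of_length (by simp; omega))
    h₂ (h₂.reduced_of_length (by simp; omega))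
  obtain ⟨t, m, hs, h₃, -⟩ := hX.exists_square heq hxy
  refine ⟨t, hs, ?_⟩
  have h₄ := (IsPathFrom.congr h₃).1 hl
  have hr := (hl.reduced_of_length hlen).congr h₃
  rcases h₄ with _ | ⟨_, h₄⟩
  have := hX.length_of_reduced h₄ hr.of_cons
  have := h₃.length_eq
  simp at this
  omega

end CubeComplex

/-! ### Halfspaces and convex sets -/

namespace CubeComplex

variable {V : Type*} {X : CubeComplex V}

theorem IsCAT0.dist_triangle (hX : X.IsCAT0) (x y z : V) :
    X.skeleton.dist x z ≤ X.skeleton.dist x y + X.skeleton.dist y z :=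
  hX.connected.dist_triangle

theorem dist_of_adj {x y : V} (h : X.skeleton.Adj x y) : X.skeleton.dist x y = 1 :=
  SimpleGraph.dist_eq_one_iff_adj.2 h

theorem IsCAT0.dist_adj (hX : X.IsCAT0) (o : V) {x y : V} (h : X.skeleton.Adj x y) :
    X.skeleton.dist o x = X.skeleton.dist o y + 1 ∨
      X.skeleton.dist o y = X.skeleton.dist o x + 1 := by
  have h₁ := hX.dist_ne_of_adj o h
  have h₂ := hX.dist_triangle o x y
  have h₃ := hX.dist_triangle o y x
  have h₄ := dist_of_adj h
  have h₅ := dist_of_adj h.symm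
  omega

theorem IsCAT0.eq_of_dist (hX : X.IsCAT0) {x y : V} (h : X.skeleton.dist x y = 0) : x = y :=
  hX.connected.dist_eq_zero_iff.1 h

theorem IsCAT0.exists_pred (hX : X.IsCAT0) {x y : V} (h : X.skeleton.dist x y ≠ 0) :
    ∃ z, X.skeleton.Adj z y ∧ X.skeleton.dist x y = X.skeleton.dist x z + 1 := by
  obtain ⟨l, hl, hlen⟩ := hX.exists_geodesic x y
  rcases hl with _ | ⟨hadj, hl⟩
  · exact absurd hlen.symm h
  · refine ⟨_, hadj.symm, ?_⟩
    have h₁ := hl.dist_le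
    have h₂ := hX.dist_adj x hadj
    simp at hlen
    omega

/-- A set of vertices is geodesically convex when it contains every vertex that lies on a
combinatorial geodesic between two of its elements. -/
def GeodConvex (X : CubeComplex V) (S : Set V) : Prop :=
  ∀ x ∈ S, ∀ y ∈ S, ∀ z : V,
    X.skeleton.dist x z + X.skeleton.dist z y = X.skeleton.dist x y → z ∈ S

/-- The halfspace of the vertices that are nearer to `a` than to `b`, for an edge `ab`. -/
def halfspace (X : CubeComplex V) (a b : V) : Set V :=
  {x | X.skeleton.dist x a < X.skeleton.dist x b}

theorem mem_halfspace {a b x : V} :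
    x ∈ X.halfspace a b ↔ X.skeleton.dist x a < X.skeleton.dist x b := Iff.rfl

theorem IsCAT0.compl_halfspace (hX : X.IsCAT0) {a b : V} (h : X.skeleton.Adj a b) :
    (X.halfspace a b)ᶜ = X.halfspace b a := by
  ext x
  have := hX.dist_ne_of_adj x h
  rw [Set.mem_compl_iff, mem_halfspace, mem_halfspace]
  omega

theorem IsCAT0.halfspace_subset_of_square (hX : X.IsCAT0) {a b c d : V}
    (hs : X.Square a b d c) : X.halfspace a b ⊆ X.halfspace c d := by
  intro x hx
  by_contra hx'
  rw [mem_halfspace] at hx hx'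
  have h₁ := hX.dist_adj x hs.adj₁
  have h₂ := hX.dist_adj x hs.adj₂
  have h₃ := hX.dist_adj x hs.adj₃
  have h₄ := hX.dist_adj x hs.adj₄
  -- Both `a` and `d` are nearer to `x` than `b` is, and `c` is not.
  obtain ⟨t, ht, hd⟩ := hX.quadrangle (o := x) hs.adj₁.symm hs.adj₂ hs.ne₁ (by omega) (by omega)
  obtain rfl := ht.unique hs.flip.rot.rot.rot
  omega

theorem IsCAT0.halfspace_eq_of_square (hX : X.IsCAT0) {a b c d : V}
    (hs : X.Square a b d c) : X.halfspace a b = X.halfspace c d :=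
  (hX.halfspace_subset_of_square hs).antisymm
    (hX.halfspace_subset_of_square hs.flip.rot)

/-- Every edge that crosses the wall of the edge `ab` defines the same halfspaces as `ab`. -/
theorem IsCAT0.halfspace_eq (hX : X.IsCAT0) {a b s t : V} (hab : X.skeleton.Adj a b)
    (hst : X.skeleton.Adj s t) (hs : s ∈ X.halfspace a b) (ht : t ∉ X.halfspace a b) :
    X.halfspace s t = X.halfspace a b := by
  induction hn : X.skeleton.dist a s generalizing s t with
  | zero =>
    obtain rfl := hX.eq_of_dist hn
    rw [mem_halfspace] at ht
    have := dist_of_adj hst.symm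
    have := hX.dist_adj t hab
    obtain rfl := hX.eq_of_dist (x := t) (y := b) (by omega)
    rfl
  | succ n ih =>
    obtain ⟨s', hs', hd⟩ := hX.exists_pred (x := a) (y := s) (by omega)
    rw [mem_halfspace] at hs ht
    have h₁ := hX.dist_adj s hab
    have h₂ := hX.dist_adj t hab
    have h₃ := hX.dist_adj a hst
    have h₄ := hX.dist_adj b hst
    have h₅ := hX.dist_adj s' hab
    have h₆ := hX.dist_adj b hs'
    have e : ∀ x y, X.skeleton.dist x y = X.skeleton.dist y x := fun _ _ =>
      SimpleGraph.dist_comm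
    rw [e s a, e s b] at h₁ hs
    rw [e t a, e t b] at h₂ ht
    rw [e s' a, e s' b] at h₅
    have hne : s' ≠ t := by
      rintro rfl
      omega
    obtain ⟨t', hsq, ht'⟩ := hX.quadrangle (o := b) hs'.symm hst hne (by omega) (by omega)
    have h₇ := hX.dist_adj a hsq.adj₃
    rw [hX.halfspace_eq_of_square hsq.flip]
    refine ih hsq.adj₂ ?_ ?_ (by omega)
    · rw [mem_halfspace, e s' a, e s' b]; omega
    · rw [mem_halfspace, e t' a, e t' b]; omega

/-- A geodesic from a point of `S` to a point outside `S` contains an edge that leaves `S`. -/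
theorem IsCAT0.exists_leaving_edge (hX : X.IsCAT0) {S : Set V} {x z : V} (hx : x ∈ S)
    (hz : z ∉ S) : ∃ s t, X.skeleton.Adj s t ∧ s ∈ S ∧ t ∉ S ∧
      X.skeleton.dist x s + 1 + X.skeleton.dist t z = X.skeleton.dist x z := by
  have key : ∀ {x z : V} (p : X.skeleton.Walk x z), x ∈ S → z ∉ S →
      ∃ s t, X.skeleton.Adj s t ∧ s ∈ S ∧ t ∉ S ∧
        X.skeleton.dist x s + 1 + X.skeleton.dist t z ≤ p.length := by
    intro x z p
    induction p with
    | nil => exact fun h h' => absurd h h'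
    | @cons x u z h p ih =>
      intro hx hz
      by_cases hu : u ∈ S
      · obtain ⟨s, t, hst, hs, ht, hd⟩ := ih hu hz
        refine ⟨s, t, hst, hs, ht, ?_⟩
        have := hX.dist_triangle x u s
        have := dist_of_adj h
        simp
        omega
      · refine ⟨x, u, h, hx, hu, ?_⟩
        have := SimpleGraph.dist_le p
        simp
        omega
  obtain ⟨p, hp⟩ := hX.connected.exists_walk_length_eq_dist x z
  obtain ⟨s, t, hst, hs, ht, hd⟩ := key p hx hz
  refine ⟨s, t, hst, hs, ht, ?_⟩
  have := hX.dist_triangle x s z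
  have := hX.dist_triangle s t z
  have := dist_of_adj hst
  omega

theorem IsCAT0.geodConvex_halfspace (hX : X.IsCAT0) {a b : V} (hab : X.skeleton.Adj a b) :
    X.GeodConvex (X.halfspace a b) := by
  intro x hx y hy z hz
  by_contra hz'
  obtain ⟨s, t, hst, hs, ht, hd⟩ := hX.exists_leaving_edge hx hz'
  rw [← hX.halfspace_eq hab hst hs ht, mem_halfspace] at hy
  have h₁ := hX.dist_triangle x s y
  have h₂ := hX.dist_triangle t z y
  rw [SimpleGraph.dist_comm, SimpleGraph.dist_comm (u := y)] at hy
  omega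

/-- The point `q` of a convex set `C` nearest to `p` is a gate: every point of `C` can be reached
from `p` by a geodesic through `q`. -/
theorem IsCAT0.gate (hX : X.IsCAT0) {C : Set V} (hC : X.GeodConvex C) {p q : V} (hq : q ∈ C)
    (hmin : ∀ c ∈ C, X.skeleton.dist p q ≤ X.skeleton.dist p c) {c : V} (hc : c ∈ C) :
    X.skeleton.dist p c = X.skeleton.dist p q + X.skeleton.dist q c := by
  induction hn : X.skeleton.dist q c using Nat.strong_induction_on generalizing c with
  | _ n ih =>
  have pred : ∀ {c}, c ∈ C → X.skeleton.dist q c ≠ 0 → ∃ c' ∈ C, X.skeleton.Adj c' c ∧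
      X.skeleton.dist q c = X.skeleton.dist q c' + 1 := by
    intro c hc h
    obtain ⟨c', hadj, hd⟩ := hX.exists_pred h
    exact ⟨c', hC q hq c hc c' (by rw [dist_of_adj hadj, hd]), hadj, hd⟩
  rcases Nat.eq_zero_or_pos n with rfl | hpos
  · obtain rfl := hX.eq_of_dist hn
    rfl
  obtain ⟨c₁, hc₁, hadj₁, hd₁⟩ := pred hc (by omega)
  have h₁ := ih _ (by omega) hc₁ rfl
  rcases hX.dist_adj p hadj₁ with h | h
  · exfalso
    have := hmin c hc
    obtain ⟨c₂, hc₂, hadj₂, hd₂⟩ := pred hc₁ (by omega)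
    have h₂ := ih _ (by omega) hc₂ rfl
    have hne : c ≠ c₂ := by rintro rfl; omega
    obtain ⟨t, hs, ht⟩ := hX.quadrangle hadj₁ hadj₂.symm hne h (by omega)
    have e₁ := dist_of_adj hs.adj₂
    have e₂ := dist_of_adj hs.adj₃
    have e₂' := dist_of_adj hs.adj₃.symm
    have e₁' := dist_of_adj hs.adj₂.symm
    have e₃ := hX.dist_triangle q c₂ c
    have e₄ := hX.dist_triangle c t c₂
    have e₅ : X.skeleton.dist c c₂ = X.skeleton.dist c₂ c := SimpleGraph.dist_comm
    have htC := hC c hc c₂ hc₂ t (by omega)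
    have e₆ := hX.dist_triangle q c₂ t
    have e₇ := hX.dist_triangle q t c
    have := ih _ (by omega) htC rfl
    omega
  · omega

theorem exists_nearest {C : Set V} (hne : C.Nonempty) (p : V) :
    ∃ q ∈ C, ∀ c ∈ C, X.skeleton.dist p q ≤ X.skeleton.dist p c := by
  obtain ⟨q, hq, hmin⟩ := (measure (X.skeleton.dist p)).wf.has_min C hne
  exact ⟨q, hq, fun c hc => not_lt.1 (hmin c hc)⟩

/-- A convex set and a vertex outside it are separated by a halfspace. -/
theorem IsCAT0.exists_separating (hX : X.IsCAT0) {C : Set V} (hC : X.GeodConvex C)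
    (hne : C.Nonempty) {p : V} (hp : p ∉ C) :
    ∃ a b, X.skeleton.Adj a b ∧ C ⊆ X.halfspace a b ∧ p ∉ X.halfspace a b := by
  obtain ⟨q, hq, hmin⟩ := exists_nearest (X := X) hne p
  have hpq : X.skeleton.dist p q ≠ 0 := fun h => hp (hX.eq_of_dist h ▸ hq)
  obtain ⟨q', hadj, hd⟩ := hX.exists_pred hpq
  refine ⟨q, q', hadj.symm, fun c hc => ?_, ?_⟩
  · have h₁ := hX.gate hC hq hmin hc
    have h₂ := hX.dist_triangle p q' c
    rw [mem_halfspace, SimpleGraph.dist_comm, SimpleGraph.dist_comm (u := c)]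
    omega
  · rw [mem_halfspace]
    omega

theorem IsCAT0.exists_geodesic_seq (hX : X.IsCAT0) (p q : V) :
    ∃ x : ℕ → V, x 0 = p ∧ x (X.skeleton.dist p q) = q ∧ ∀ i j, i ≤ j →
      j ≤ X.skeleton.dist p q → X.skeleton.dist (x i) (x j) = j - i := by
  obtain ⟨w, hw⟩ := hX.connected.exists_walk_length_eq_dist p q
  have h0 : w.getVert 0 = p := w.getVert_zero
  have h1 : w.getVert (X.skeleton.dist p q) = q := hw ▸ w.getVert_length
  refine ⟨w.getVert, h0, h1, ?_⟩
  have hle : ∀ i k, i + k ≤ X.skeleton.dist p q →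
      X.skeleton.dist (w.getVert i) (w.getVert (i + k)) ≤ k := by
    intro i k
    induction k with
    | zero => simp
    | succ k ih =>
      intro hk
      have h₁ := ih (by omega)
      have h₂ := dist_of_adj (w.adj_getVert_succ (i := i + k) (by omega))
      have h₃ := hX.dist_triangle (w.getVert i) (w.getVert (i + k)) (w.getVert (i + (k + 1)))
      rw [← add_assoc] at *
      omega
  intro i j hij hj
  obtain ⟨k, rfl⟩ := Nat.exists_eq_add_of_le hij
  obtain ⟨m, hm⟩ := Nat.exists_eq_add_of_le hj
  have h₁ := hle 0 i (by omega)
  have h₂ := hle i k hj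
  have h₃ := hle (i + k) m (by omega)
  rw [← hm, h1] at h₃
  rw [zero_add, h0] at h₁
  have h₄ := hX.dist_triangle p (w.getVert i) q
  have h₅ := hX.dist_triangle (w.getVert i) (w.getVert (i + k)) q
  omega

/-- If the wall of the edge `ab` separates `p` from the convex set `C` and is crossed by an edge
at some vertex of `C`, then it is crossed by an edge at the gate `q` of `p` in `C`. -/
theorem IsCAT0.exists_edge_at_gate (hX : X.IsCAT0) {C : Set V} (hC : X.GeodConvex C) {p q : V}
    (hq : q ∈ C) (hmin : ∀ c ∈ C, X.skeleton.dist p q ≤ X.skeleton.dist p c) {a b : V}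
    (hab : X.skeleton.Adj a b) (hCa : C ⊆ X.halfspace a b) (hp : p ∉ X.halfspace a b)
    {c c' : V} (hc : c ∈ C) (hcc : X.skeleton.Adj c c') (hc' : c' ∉ X.halfspace a b) :
    ∃ q', X.skeleton.Adj q q' ∧ X.halfspace q q' = X.halfspace a b := by
  induction hn : X.skeleton.dist q c generalizing c c' with
  | zero =>
    obtain rfl := hX.eq_of_dist hn
    exact ⟨c', hcc, hX.halfspace_eq hab hcc (hCa hc) hc'⟩
  | succ n ih =>
    -- The neighbours `c'` and `c₂` of `c` are both nearer to `p`, so they span a square, and this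
    -- square carries the wall over from the edge `cc'` to an edge at `c₂`.
    obtain ⟨c₂, hadj, hd⟩ := hX.exists_pred (x := q) (y := c) (by omega)
    have hc₂ : c₂ ∈ C := hC q hq c hc c₂ (by rw [dist_of_adj hadj, hd])
    have h₁ := hX.gate hC hq hmin hc
    have h₂ := hX.gate hC hq hmin hc₂
    have hw := hX.halfspace_eq hab hcc (hCa hc) hc'
    have hp' := hp
    rw [← hw, mem_halfspace] at hp'
    have h₃ := hX.dist_adj p hcc
    have hne : c' ≠ c₂ := fun e => hc' (e ▸ hCa hc₂)
    obtain ⟨t, hs, -⟩ := hX.quadrangle (o := p) hcc hadj.symm hne (by omega) (by omega)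
    have ht : t ∉ X.halfspace a b := by
      rw [← hw, hX.halfspace_eq_of_square hs, mem_halfspace]
      simp
    exact ih hc₂ hs.adj₃.symm ht (by omega)

/-- If vertices have at most `D` neighbours, then the intersection of all halfspaces containing
the 1-neighbourhood of a convex set `C` lies in the `D`-neighbourhood of `C`. Indeed, the walls
crossed by a geodesic from `p` to its gate `q` in `C` separate `p` from `C`; if none of them
separates `p` from the 1-neighbourhood of `C`, then they are crossed by different edges at `q`. -/
theorem IsCAT0.exists_thickening_one (hX : X.IsCAT0) {D : ℕ}
    (hD : ∀ v, (X.skeleton.neighborSet v).Finite ∧ (X.skeleton.neighborSet v).ncard ≤ D)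
    {C : Set V} (hC : X.GeodConvex C) (hne : C.Nonempty) :
    ∃ C' : Set V, X.GeodConvex C' ∧ C ⊆ C' ∧
      (∀ c ∈ C, ∀ x, X.skeleton.Adj c x → x ∈ C') ∧
      ∀ p ∈ C', ∃ q ∈ C, X.skeleton.dist p q ≤ D := by
  let C' : Set V := {p | ∀ a b, X.skeleton.Adj a b → C ⊆ X.halfspace a b →
    (∀ c ∈ C, ∀ x, X.skeleton.Adj c x → x ∈ X.halfspace a b) → p ∈ X.halfspace a b}
  refine ⟨C', ?_, ?_, ?_, ?_⟩
  · intro x hx y hy z hz a b hab h h'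
    exact hX.geodConvex_halfspace hab x (hx a b hab h h') y (hy a b hab h h') z hz
  · exact fun c hc a b _ h _ => h hc
  · exact fun c hc x hcx a b _ _ h' => h' c hc x hcx
  · intro p hp
    obtain ⟨q, hq, hmin⟩ := exists_nearest (X := X) hne p
    refine ⟨q, hq, ?_⟩
    obtain ⟨x, hx0, hx1, hx⟩ := hX.exists_geodesic_seq p q
    have hedge : ∀ i : Fin (X.skeleton.dist p q), ∃ q', X.skeleton.Adj q q' ∧
        X.halfspace q q' = X.halfspace (x (i + 1)) (x i) := by
      rintro ⟨i, hi⟩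
      have hadj : X.skeleton.Adj (x (i + 1)) (x i) := by
        rw [SimpleGraph.adj_comm, ← SimpleGraph.dist_eq_one_iff_adj,
          hx i (i + 1) (by omega) (by omega)]
        omega
      have hi₁ := hx 0 i (by omega) (by omega)
      have hi₂ := hx 0 (i + 1) (by omega) (by omega)
      have hi₃ := hx (i + 1) _ (by omega) le_rfl
      rw [hx0] at hi₁ hi₂
      rw [hx1] at hi₃
      have hp' : p ∉ X.halfspace (x (i + 1)) (x i) := by
        rw [mem_halfspace]
        omega
      have hCx : C ⊆ X.halfspace (x (i + 1)) (x i) := by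
        intro c hc
        have h₁ := hX.gate hC hq hmin hc
        have h₂ := hX.dist_triangle p (x i) c
        have h₃ := hX.dist_triangle (x (i + 1)) q c
        rw [mem_halfspace, SimpleGraph.dist_comm, SimpleGraph.dist_comm (u := c)]
        omega
      have : ∃ c ∈ C, ∃ y, X.skeleton.Adj c y ∧ y ∉ X.halfspace (x (i + 1)) (x i) := by
        by_contra! hcon
        exact hp' (hp _ _ hadj hCx hcon)
      obtain ⟨c, hc, y, hcy, hy⟩ := this
      exact hX.exists_edge_at_gate hC hq hmin hadj hCx hp' hc hcy hy
    choose f hf hw using hedge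
    have hlt : ∀ i j : Fin (X.skeleton.dist p q), i < j → f i ≠ f j := by
      rintro ⟨i, hi⟩ ⟨j, hj⟩ hij he
      rw [Fin.mk_lt_mk] at hij
      have h := (hw ⟨i, hi⟩).symm.trans ((congrArg _ he).trans (hw ⟨j, hj⟩))
      have h₁ : x (i + 1) ∈ X.halfspace (x (i + 1)) (x i) := by
        have := hx i (i + 1) (by omega) (by omega)
        rw [mem_halfspace, SimpleGraph.dist_self, SimpleGraph.dist_comm]
        omega
      have h₂ : x (i + 1) ∉ X.halfspace (x (j + 1)) (x j) := by
        have := hx (i + 1) j (by omega) (by omega)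
        have := hx (i + 1) (j + 1) (by omega) (by omega)
        rw [mem_halfspace]
        omega
      exact h₂ (h ▸ h₁)
    have hinj : Function.Injective f := by
      intro i j he
      rcases lt_trichotomy i j with h | h | h
      · exact absurd he (hlt i j h)
      · exact h
      · exact absurd he.symm (hlt j i h)
    calc X.skeleton.dist p q = (Set.range f).ncard := by
          rw [← Set.image_univ, Set.ncard_image_of_injective _ hinj, Set.ncard_univ,
            Nat.card_fin]
      _ ≤ (X.skeleton.neighborSet q).ncard := Set.ncard_le_ncard (by
          rintro _ ⟨i, rfl⟩
          exact hf i) (hD q).1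
      _ ≤ D := (hD q).2

/-- Every neighbourhood of a convex set lies in a convex set at finite distance from it. -/
theorem IsCAT0.exists_thickening (hX : X.IsCAT0) {D : ℕ}
    (hD : ∀ v, (X.skeleton.neighborSet v).Finite ∧ (X.skeleton.neighborSet v).ncard ≤ D)
    {C : Set V} (hC : X.GeodConvex C) (hne : C.Nonempty) (R : ℕ) :
    ∃ C' : Set V, X.GeodConvex C' ∧ (∀ c ∈ C, ∀ x, X.skeleton.dist c x ≤ R → x ∈ C') ∧
      ∀ p ∈ C', ∃ q ∈ C, X.skeleton.dist p q ≤ R * D := by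
  induction R with
  | zero =>
    refine ⟨C, hC, fun c hc x hx => ?_, fun p hp => ⟨p, hp, by simp⟩⟩
    exact hX.eq_of_dist (Nat.le_zero.1 hx) ▸ hc
  | succ R ih =>
    obtain ⟨C₁, hC₁, hsub, hfar⟩ := ih
    have hCC : C ⊆ C₁ := fun c hc => hsub c hc c (by simp)
    obtain ⟨C₂, hC₂, h₁₂, hadj, hfar₂⟩ := hX.exists_thickening_one hD hC₁ (hne.mono hCC)
    refine ⟨C₂, hC₂, fun c hc x hx => ?_, fun p hp => ?_⟩
    · by_cases h0 : X.skeleton.dist c x = 0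
      · exact hX.eq_of_dist h0 ▸ h₁₂ (hCC hc)
      · obtain ⟨y, hy, hd⟩ := hX.exists_pred h0
        exact hadj y (hsub c hc y (by omega)) x hy
    · obtain ⟨q, hq, hpq⟩ := hfar₂ p hp
      obtain ⟨r, hr, hqr⟩ := hfar q hq
      refine ⟨r, hr, ?_⟩
      have := hX.dist_triangle p q r
      rw [add_mul, one_mul]
      omega

end CubeComplex

/-! ### Group actions, edges of trees, and convex-cocompactness -/

/-- If the points `g⁻¹ • w` range in a finite set, then the elements `g` range in finitely many
right cosets of the stabiliser of `w`. -/
theorem MulAction.exists_finite_transversal {Q E : Type*} [Group Q] [MulAction Q E] (w : E)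
    {A : Set E} (hA : A.Finite) :
    ∃ G : Set Q, G.Finite ∧ ∀ g : Q, g⁻¹ • w ∈ A →
      ∃ s ∈ MulAction.stabilizer Q w, ∃ k ∈ G, g = s * k := by
  classical
  let f : E → Q := fun e => if h : ∃ k : Q, k⁻¹ • w = e then h.choose else 1
  refine ⟨f '' A, hA.image f, fun g hg => ?_⟩
  have h : ∃ k : Q, k⁻¹ • w = g⁻¹ • w := ⟨g, rfl⟩
  have hf : (f (g⁻¹ • w))⁻¹ • w = g⁻¹ • w := by
    simp only [f]
    rw [dif_pos h]
    exact h.choose_spec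
  refine ⟨g * (f (g⁻¹ • w))⁻¹, ?_, f (g⁻¹ • w), ⟨_, hg, rfl⟩, by group⟩
  rw [MulAction.mem_stabilizer_iff, mul_smul, hf, smul_inv_smul]

namespace SimpleGraph

variable {W : Type*} {T : SimpleGraph W}

/-- The vertices that can be reached from `a` without traversing the edge `ab`. -/
def side (T : SimpleGraph W) (a b : W) : Set W :=
  {s | (T.deleteEdges {s(a, b)}).Reachable a s}

theorem self_mem_side (a b : W) : a ∈ T.side a b := Reachable.refl _

theorem edge_eq_of_leaves_side {a b s t : W} (h : T.Adj s t) (hs : s ∈ T.side a b)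
    (ht : t ∉ T.side a b) : s(s, t) = s(a, b) := by
  by_contra hne
  refine ht (Reachable.trans hs (Adj.reachable ?_))
  rw [deleteEdges_adj]
  exact ⟨h, hne⟩

/-- Some edge at `w` separates `w` from `s`: the first edge of the path from `w` to `s`. -/
theorem IsTree.exists_notMem_side (hT : T.IsTree) {w s : W} (h : s ≠ w) :
    ∃ b, T.Adj w b ∧ s ∉ T.side w b := by
  obtain ⟨p, hp⟩ := (hT.connected w s).exists_isPath
  cases p with
  | nil => exact absurd rfl h
  | @cons _ b _ hadj p =>
    refine ⟨b, hadj, fun hs => ?_⟩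
    rw [Walk.cons_isPath_iff] at hp
    have hbr := isAcyclic_iff_forall_adj_isBridge.1 hT.isAcyclic hadj
    rw [isBridge_iff] at hbr
    have hbs : (T.deleteEdges {s(w, b)}).Reachable b s := by
      refine ⟨p.toDeleteEdges _ fun e he he' => ?_⟩
      rw [Set.mem_singleton_iff.1 he'] at he
      exact hp.2 (p.fst_mem_support_of_mem_edges he)
    exact hbr (Reachable.trans hs hbs.symm)

/-- Only finitely many edges separate two given vertices of a connected graph. -/
theorem Connected.finite_separating (hT : T.Connected) (s t : W) :
    {e : W × W | s ∈ T.side e.1 e.2 ∧ t ∉ T.side e.1 e.2}.Finite := by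
  obtain ⟨p⟩ := hT s t
  have key : ∀ {s t} (p : T.Walk s t) (a b : W), s ∈ T.side a b → t ∉ T.side a b →
      s(a, b) ∈ p.edges := by
    intro s t p a b
    induction p with
    | nil => exact fun h h' => absurd h h'
    | @cons s u t hadj p ih =>
      intro hs ht
      rw [Walk.edges_cons, List.mem_cons]
      by_cases hu : u ∈ T.side a b
      · exact .inr (ih hu ht)
      · exact .inl (edge_eq_of_leaves_side hadj hs hu).symm
  have hfin : {x : W | x ∈ p.support}.Finite := p.support.finite_toSet
  refine (hfin.prod hfin).subset ?_
  rintro ⟨a, b⟩ ⟨hs, ht⟩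
  have := key p a b hs ht
  exact ⟨p.fst_mem_support_of_mem_edges this, p.snd_mem_support_of_mem_edges this⟩

theorem smul_mem_side {Q : Type*} [Group Q] [MulAction Q W]
    (hT : ∀ (g : Q) (a b : W), T.Adj a b → T.Adj (g • a) (g • b)) (g : Q) {a b s : W}
    (hs : s ∈ T.side a b) : g • s ∈ T.side (g • a) (g • b) := by
  let φ : T.deleteEdges {s(a, b)} →g T.deleteEdges {s(g • a, g • b)} :=
    ⟨fun x => g • x, fun {x y} h => by
      rw [deleteEdges_adj] at h ⊢
      refine ⟨hT g x y h.1, fun he => h.2 ?_⟩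
      simpa [Sym2.eq_iff] using he⟩
  exact Reachable.map φ hs

theorem smul_mem_side_iff {Q : Type*} [Group Q] [MulAction Q W]
    (hT : ∀ (g : Q) (a b : W), T.Adj a b → T.Adj (g • a) (g • b)) (g : Q) {a b s : W} :
    g • s ∈ T.side (g • a) (g • b) ↔ s ∈ T.side a b :=
  ⟨fun h => by simpa using smul_mem_side hT g⁻¹ h, smul_mem_side hT g⟩

end SimpleGraph

namespace CubeComplex

variable {V : Type*} {X : CubeComplex V}

/-- The smallest geodesically convex set containing `Y`. -/
def hull (X : CubeComplex V) (Y : Set V) : Set V :=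
  {z | ∀ S, X.GeodConvex S → Y ⊆ S → z ∈ S}

theorem subset_hull (Y : Set V) : Y ⊆ X.hull Y := fun _ hy _ _ h => h hy

theorem geodConvex_hull (Y : Set V) : X.GeodConvex (X.hull Y) :=
  fun x hx y hy z hz S hS hYS => hS x (hx S hS hYS) y (hy S hS hYS) z hz

/-- The subcomplex of all cubes with vertices in `S`. -/
def fullSubcomplex (X : CubeComplex V) (S : Set V) : X.Subcomplex where
  cubes := {c | c ∈ X.cubes ∧ c ⊆ S}
  subset := fun _ h => h.1
  face_mem := fun _ hc _ hd h => ⟨hd, h.trans hc.2⟩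

theorem verts_fullSubcomplex (S : Set V) : (X.fullSubcomplex S).verts = S := by
  ext v
  exact ⟨fun h => h.2 rfl, fun h => ⟨X.singleton_mem v, Set.singleton_subset_iff.2 h⟩⟩

variable {Q : Type*} [Group Q] [MulAction Q V]

namespace IsCocompactCubulation

variable (hX : X.IsCocompactCubulation Q)
include hX

theorem smul_adj (g : Q) {x y : V} (h : X.skeleton.Adj x y) :
    X.skeleton.Adj (g • x) (g • y) := by
  refine ⟨fun e => h.1 (smul_left_cancel g e), ?_⟩
  have := hX.smul_mem g _ h.2
  rwa [← Set.image_smul, Set.image_pair] at this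

theorem dist_smul (g : Q) (x y : V) :
    X.skeleton.dist (g • x) (g • y) = X.skeleton.dist x y := by
  have key : ∀ (g : Q) (x y : V), X.skeleton.dist (g • x) (g • y) ≤ X.skeleton.dist x y := by
    intro g x y
    obtain ⟨p, hp⟩ := hX.cat0.connected.exists_walk_length_eq_dist x y
    let φ : X.skeleton →g X.skeleton := ⟨fun x => g • x, fun h => hX.smul_adj g h⟩
    rw [← hp, ← p.length_map φ]
    exact SimpleGraph.dist_le _
  refine (key g x y).antisymm ?_
  simpa using key g⁻¹ (g • x) (g • y)

theorem geodConvex_preimage (g : Q) {S : Set V} (hS : X.GeodConvex S) :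
    X.GeodConvex ((g • ·) ⁻¹' S) := by
  intro x hx y hy z hz
  refine hS _ hx _ hy _ ?_
  rw [hX.dist_smul, hX.dist_smul, hX.dist_smul, hz]

theorem finite_transporter {A B : Set V} (hA : A.Finite) (hB : B.Finite) :
    {g : Q | ∃ a ∈ A, g • a ∈ B}.Finite := by
  refine (hX.proper (A ∪ B) (hA.union hB)).subset ?_
  rintro g ⟨a, ha, hb⟩
  exact ⟨g • a, Set.smul_mem_smul_set (.inl ha), .inr hb⟩

theorem exists_finite_cover : ∃ V₀ : Set V, V₀.Finite ∧ ∀ x y : V,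
    X.skeleton.Adj x y ∨ x = y → ∃ g : Q, g⁻¹ • x ∈ V₀ ∧ g⁻¹ • y ∈ V₀ := by
  obtain ⟨K, hK, hKX, hcov⟩ := hX.cocompact
  refine ⟨⋃₀ K, hK.sUnion fun c hc => cube_finite (hKX hc), fun x y hxy => ?_⟩
  have hc : ({x, y} : Set V) ∈ X.cubes := by
    rcases hxy with h | rfl
    · exact h.2
    · rw [Set.pair_eq_singleton]
      exact X.singleton_mem x
  obtain ⟨g, k, hk, he⟩ := hcov _ hc
  refine ⟨g, ⟨k, hk, ?_⟩, ⟨k, hk, ?_⟩⟩ <;> rw [← Set.mem_smul_set_iff_inv_smul_mem, ← he] <;> simp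

theorem finite_neighborSet (v : V) : (X.skeleton.neighborSet v).Finite := by
  obtain ⟨V₀, hV₀, hcov⟩ := hX.exists_finite_cover
  have hfin := hX.finite_transporter (Set.finite_singleton v) hV₀
  refine ((hfin.prod hV₀).image fun e : Q × V => e.1⁻¹ • e.2).subset fun y hy => ?_
  obtain ⟨g, hg, hg'⟩ := hcov v y (.inl hy)
  exact ⟨(g⁻¹, g⁻¹ • y), ⟨⟨v, rfl, hg⟩, hg'⟩, by simp⟩

theorem exists_degree_bound : ∃ D, ∀ v, (X.skeleton.neighborSet v).Finite ∧
    (X.skeleton.neighborSet v).ncard ≤ D := by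
  obtain ⟨V₀, hV₀, hcov⟩ := hX.exists_finite_cover
  obtain ⟨D, hD⟩ := (hV₀.image fun v => (X.skeleton.neighborSet v).ncard).bddAbove
  refine ⟨D, fun v => ⟨hX.finite_neighborSet v, ?_⟩⟩
  obtain ⟨g, hg, -⟩ := hcov v v (.inr rfl)
  refine le_trans ?_ (hD ⟨_, hg, rfl⟩)
  refine Set.ncard_le_ncard_of_injOn (g⁻¹ • ·) (fun y hy => hX.smul_adj g⁻¹ hy)
    (fun _ _ _ _ h => smul_left_cancel _ h) (hX.finite_neighborSet _)

theorem finite_ball (v : V) (R : ℕ) : {x | X.skeleton.dist v x ≤ R}.Finite := by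
  induction R with
  | zero =>
    refine (Set.finite_singleton v).subset fun x hx => ?_
    exact (hX.cat0.eq_of_dist (Nat.le_zero.1 hx)).symm
  | succ R ih =>
    refine (ih.union (ih.biUnion fun y _ => hX.finite_neighborSet y)).subset fun x hx => ?_
    by_cases h0 : X.skeleton.dist v x = 0
    · exact .inl (show X.skeleton.dist v x ≤ R by omega)
    · obtain ⟨y, hy, hd⟩ := hX.cat0.exists_pred h0
      rw [Set.mem_ofPred_eq] at hx
      exact .inr (Set.mem_biUnion (show y ∈ {x | X.skeleton.dist v x ≤ R} from (by
        rw [Set.mem_ofPred_eq]; omega)) hy)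

theorem finite_cubes (v : V) : {c | c ∈ X.cubes ∧ v ∈ c}.Finite := by
  obtain ⟨K, hK, hKX, hcov⟩ := hX.cocompact
  have hfin := hX.finite_transporter (hK.sUnion fun c hc => cube_finite (hKX hc))
    (Set.finite_singleton v)
  refine ((hfin.prod hK).image fun e : Q × Set V => e.1 • e.2).subset ?_
  rintro c ⟨hc, hv⟩
  obtain ⟨g, k, hk, rfl⟩ := hcov c hc
  obtain ⟨a, ha, rfl⟩ := hv
  exact ⟨(g, k), ⟨⟨a, ⟨k, hk, ha⟩, rfl⟩, hk⟩, rfl⟩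

/-- Convex-cocompactness in terms of vertex sets. -/
theorem isConvexCocompact_iff (H : Subgroup Q) : X.IsConvexCocompact H ↔
    ∃ S : Set V, S.Nonempty ∧ X.GeodConvex S ∧ (∀ h ∈ H, ∀ x ∈ S, h • x ∈ S) ∧
      ∃ F : Set V, F.Finite ∧ ∀ x ∈ S, ∃ h ∈ H, h • x ∈ F := by
  constructor
  · rintro ⟨C, ⟨c, hc⟩, hconv, hH, K, hK, hKC, hcov⟩
    refine ⟨C.verts, ?_, hconv.geodesic, ?_, ⋃₀ K,
      hK.sUnion fun c hc => cube_finite (C.subset (hKC hc)), ?_⟩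
    · obtain ⟨v, hv⟩ := cube_nonempty (C.subset hc)
      exact ⟨v, C.face_mem c hc _ (X.singleton_mem v) (Set.singleton_subset_iff.2 hv)⟩
    · intro h hh x hx
      have := hH h hh _ hx
      rwa [Set.smul_set_singleton] at this
    · intro x hx
      obtain ⟨h, hh, k, hk, he⟩ := hcov _ hx
      refine ⟨h⁻¹, H.inv_mem hh, k, hk, ?_⟩
      rw [← Set.mem_smul_set_iff_inv_smul_mem, ← he]
      rfl
  · rintro ⟨S, ⟨v, hv⟩, hconv, hH, F, hF, hcov⟩
    have hHS : ∀ h ∈ H, ∀ c ∈ (X.fullSubcomplex S).cubes, h • c ∈ (X.fullSubcomplex S).cubes := by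
      rintro h hh c ⟨hc, hcS⟩
      refine ⟨hX.smul_mem h c hc, ?_⟩
      rintro _ ⟨x, hx, rfl⟩
      exact hH h hh x (hcS hx)
    refine ⟨X.fullSubcomplex S, ⟨{v}, X.singleton_mem v, Set.singleton_subset_iff.2 hv⟩,
      ⟨?_, ?_⟩, hHS, {c | c ∈ (X.fullSubcomplex S).cubes ∧ (c ∩ F).Nonempty}, ?_,
      fun c hc => hc.1, ?_⟩
    · rw [verts_fullSubcomplex]
      exact fun c hc h => ⟨hc, h⟩
    · rw [verts_fullSubcomplex]
      exact hconv
    · refine (hF.biUnion fun v _ => hX.finite_cubes v).subset ?_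
      rintro c ⟨⟨hc, -⟩, v, hv, hvF⟩
      exact Set.mem_biUnion hvF ⟨hc, hv⟩
    · intro c hc
      obtain ⟨x, hx⟩ := cube_nonempty hc.1
      obtain ⟨h, hh, hF⟩ := hcov x (hc.2 hx)
      exact ⟨h⁻¹, H.inv_mem hh, h • c, ⟨hHS h hh c hc, h • x, Set.smul_mem_smul_set hx, hF⟩,
        by simp⟩

end IsCocompactCubulation

end CubeComplex

/-! ### Crossing points of edges of the tree -/

namespace CubeComplex

variable {V : Type*} {X : CubeComplex V} {Q : Type*} [Group Q] [MulAction Q V]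
variable {W : Type*} [MulAction Q W]

variable (Q) in
/-- Label every vertex `p` of `X` by all vertices `g • w` of `T` for which `p` lies in the translate
`g • V₀`. The vertex `p` is a crossing point of the edge `wb` of `T` when it carries a label on the
side of `w`, and it or a neighbour of it carries a label on the other side. -/
def IsCrossing (X : CubeComplex V) (T : SimpleGraph W) (V₀ : Set V) (w b : W) (p : V) : Prop :=
  ∃ (p' : V) (g g' : Q), (X.skeleton.Adj p p' ∨ p = p') ∧ g⁻¹ • p ∈ V₀ ∧ g'⁻¹ • p' ∈ V₀ ∧
    g • w ∈ T.side w b ∧ g' • w ∉ T.side w b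

namespace IsCocompactCubulation

variable (hX : X.IsCocompactCubulation Q) {T : SimpleGraph W} {V₀ : Set V}
include hX

/-- If the endpoints of a geodesic have labels on different sides of the edge `wb`, then the
geodesic contains a crossing point of this edge. -/
theorem exists_isCrossing
    (hcov : ∀ x y : V, X.skeleton.Adj x y ∨ x = y → ∃ g : Q, g⁻¹ • x ∈ V₀ ∧ g⁻¹ • y ∈ V₀)
    {w b : W} {x p : V} {g g' : Q} (hx : g⁻¹ • x ∈ V₀) (hg : g • w ∈ T.side w b)
    (hp : g'⁻¹ • p ∈ V₀) (hg' : g' • w ∉ T.side w b) :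
    ∃ q, IsCrossing Q X T V₀ w b q ∧
      X.skeleton.dist x q + X.skeleton.dist q p = X.skeleton.dist x p := by
  let S : Set V := {y | ∃ g : Q, g⁻¹ • y ∈ V₀ ∧ g • w ∈ T.side w b}
  by_cases hpS : p ∈ S
  · obtain ⟨k, hk, hkw⟩ := hpS
    exact ⟨p, ⟨p, k, g', .inr rfl, hk, hp, hkw, hg'⟩, by simp⟩
  · obtain ⟨s, t, hst, ⟨k, hk, hkw⟩, ht, hd⟩ :=
      hX.cat0.exists_leaving_edge (S := S) ⟨g, hx, hg⟩ hpS
    obtain ⟨m, hm, -⟩ := hcov t t (.inr rfl)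
    refine ⟨s, ⟨t, k, m, .inl hst, hk, hm, hkw, fun h => ht ⟨m, hm, h⟩⟩, ?_⟩
    have := hX.cat0.dist_triangle x s p
    have := hX.cat0.dist_triangle s t p
    have := dist_of_adj hst
    omega

/-- Up to the action, only finitely many edges of `T` are crossed. -/
theorem finite_crossed (hV₀ : V₀.Finite) (hT : T.Connected)
    (hadj : ∀ (g : Q) (a b : W), T.Adj a b → T.Adj (g • a) (g • b)) (w : W) :
    ∃ E : Set (W × W), E.Finite ∧ ∀ b p, IsCrossing Q X T V₀ w b p →
      ∃ g : Q, g⁻¹ • p ∈ V₀ ∧ g⁻¹ • (w, b) ∈ E := by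
  let V₁ : Set V := ⋃ v ∈ V₀, {x | X.skeleton.dist v x ≤ 1}
  have hV₁ : V₁.Finite := hV₀.biUnion fun v _ => hX.finite_ball v 1
  refine ⟨⋃ h ∈ {h : Q | ∃ a ∈ V₀, h • a ∈ V₁},
    {e | w ∈ T.side e.1 e.2 ∧ h • w ∉ T.side e.1 e.2},
    (hX.finite_transporter hV₀ hV₁).biUnion fun h _ => hT.finite_separating w (h • w), ?_⟩
  rintro b p ⟨p', g, g', hpp, hp, hp', hg, hg'⟩
  refine ⟨g, hp, Set.mem_biUnion (x := g⁻¹ * g') ⟨g'⁻¹ • p', hp', ?_⟩ ⟨?_, ?_⟩⟩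
  · refine Set.mem_biUnion hp ?_
    rw [Set.mem_ofPred_eq, mul_smul, smul_inv_smul, hX.dist_smul]
    rcases hpp with h | rfl
    · exact (dist_of_adj h).le
    · simp
  · rw [← SimpleGraph.smul_mem_side_iff hadj g]
    simpa using hg
  · rw [← SimpleGraph.smul_mem_side_iff hadj g]
    simpa [mul_smul] using hg'

/-- The crossing points of an edge lie in finitely many orbits of the edge stabiliser, hence in a
bounded neighbourhood of a convex set on which this stabiliser acts cocompactly, and hence in a
convex set that meets finitely many orbits of the edge stabiliser, a fortiori of the vertex
stabiliser. -/
theorem exists_convex_crossing (hV₀ : V₀.Finite) {E : Set (W × W)} (hE : E.Finite) {w b : W}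
    (hcross : ∀ p, IsCrossing Q X T V₀ w b p → ∃ g : Q, g⁻¹ • p ∈ V₀ ∧ g⁻¹ • (w, b) ∈ E)
    (hcc : X.IsConvexCocompact (MulAction.stabilizer Q w ⊓ MulAction.stabilizer Q b)) :
    ∃ K : Set V, X.GeodConvex K ∧ K.Nonempty ∧ (∀ p, IsCrossing Q X T V₀ w b p → p ∈ K) ∧
      ∃ M : Set V, M.Finite ∧ ∀ p ∈ K, ∃ s ∈ MulAction.stabilizer Q w, s • p ∈ M := by
  obtain ⟨S, ⟨c, hc⟩, hS, hinv, F, hF, hcof⟩ := (hX.isConvexCocompact_iff _).1 hcc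
  obtain ⟨G, hG, hGcov⟩ := MulAction.exists_finite_transversal (Q := Q) (w, b) hE
  obtain ⟨D, hD⟩ := hX.exists_degree_bound
  obtain ⟨R, hR⟩ := ((hG.prod hV₀).image fun e : Q × V =>
    X.skeleton.dist c (e.1 • e.2)).bddAbove
  obtain ⟨K, hK, hKR, hKS⟩ := hX.cat0.exists_thickening hD hS ⟨c, hc⟩ R
  refine ⟨K, hK, ⟨c, hKR c hc c (by simp)⟩, ?_, ⋃ f ∈ F, {x | X.skeleton.dist f x ≤ R * D},
    hF.biUnion fun f _ => hX.finite_ball f _, ?_⟩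
  · intro p hp
    obtain ⟨g, hg, hgE⟩ := hcross p hp
    obtain ⟨s, hs, k, hk, rfl⟩ := hGcov g hgE
    rw [MulAction.mem_stabilizer_iff, Prod.smul_mk, Prod.mk.injEq] at hs
    refine hKR (s • c) (hinv s hs c hc) p ?_
    have := hR ⟨(k, (s * k)⁻¹ • p), ⟨hk, hg⟩, rfl⟩
    dsimp only at this
    rw [← hX.dist_smul s] at this
    simpa [← mul_smul] using this
  · intro p hp
    obtain ⟨q, hq, hd⟩ := hKS p hp
    obtain ⟨h, hh, hF'⟩ := hcof q hq
    refine ⟨h, hh.1, Set.mem_biUnion hF' ?_⟩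
    rw [Set.mem_ofPred_eq, hX.dist_smul, SimpleGraph.dist_comm]
    exact hd

/-- The convex hull of an orbit of the stabiliser of `w` consists of vertices labelled `w` and
of points of the convex sets around the edges at `w`. Otherwise a wall would separate a point `p` of
the hull from such a set; since this wall has a point of the orbit on the side of `p`, there would
be a geodesic on that side of the wall that crosses the edge. -/
theorem mem_of_mem_hull
    (hcov : ∀ x y : V, X.skeleton.Adj x y ∨ x = y → ∃ g : Q, g⁻¹ • x ∈ V₀ ∧ g⁻¹ • y ∈ V₀)
    {w b : W} {x₀ : V} (hx₀ : x₀ ∈ V₀) {K : Set V} (hK : X.GeodConvex K) (hne : K.Nonempty)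
    (hcross : ∀ p, IsCrossing Q X T V₀ w b p → p ∈ K) {p : V}
    (hp : p ∈ X.hull (MulAction.orbit (MulAction.stabilizer Q w) x₀)) {g : Q}
    (hg : g⁻¹ • p ∈ V₀) (hgw : g • w ∉ T.side w b) : p ∈ K := by
  by_contra hpK
  obtain ⟨a, a', hadj, hKa, hpa⟩ := hX.cat0.exists_separating hK hne hpK
  have : ¬ MulAction.orbit (MulAction.stabilizer Q w) x₀ ⊆ X.halfspace a a' := fun h =>
    hpa (hp _ (hX.cat0.geodConvex_halfspace hadj) h)
  obtain ⟨_, ⟨⟨s, hs⟩, rfl⟩, hy⟩ := Set.not_subset.1 this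
  obtain ⟨q, hq, hd⟩ := hX.exists_isCrossing (T := T) (w := w) (b := b) hcov (x := s • x₀) (p := p)
    (g := s) (by simpa using hx₀) (by
      rw [MulAction.mem_stabilizer_iff.1 hs]; exact SimpleGraph.self_mem_side w b) hg hgw
  rw [← Set.mem_compl_iff, hX.cat0.compl_halfspace hadj] at hpa hy
  have hq' := hX.cat0.geodConvex_halfspace hadj.symm _ hy _ hpa q hd
  rw [← hX.cat0.compl_halfspace hadj] at hq'
  exact hq' (hKa (hcross q hq))

theorem smul_mem_hull_orbit (H : Subgroup Q) (x₀ : V) {h : Q} (hh : h ∈ H) {p : V}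
    (hp : p ∈ X.hull (MulAction.orbit H x₀)) : h • p ∈ X.hull (MulAction.orbit H x₀) := by
  intro S hS hY
  refine hp _ (hX.geodConvex_preimage h hS) ?_
  rintro _ ⟨k, rfl⟩
  exact hY ⟨⟨h, hh⟩ * k, mul_smul (⟨h, hh⟩ : H) k x₀⟩

end IsCocompactCubulation

end CubeComplex

theorem mainTheorem3 {Q : Type*} {V : Type*} {W : Type*} [Group Q]
    [MulAction Q V] (X : CubeComplex V) (hX : X.IsCocompactCubulation Q)
    [MulAction Q W] (T : SimpleGraph W) (hT : IsSplitting Q T)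
    (hedge : ∀ a b : W, T.Adj a b →
      X.IsConvexCocompact (MulAction.stabilizer Q a ⊓ MulAction.stabilizer Q b))
    (w : W) :
    X.IsConvexCocompact (MulAction.stabilizer Q w) := by
  obtain ⟨V₀, hV₀, hcov⟩ := hX.exists_finite_cover
  obtain ⟨v⟩ := hX.cat0.connected.nonempty
  obtain ⟨g₀, hx₀, -⟩ := hcov v v (.inr rfl)
  obtain ⟨E, hE, hcross⟩ := hX.finite_crossed hV₀ hT.isTree.connected hT.smul_adj w
  obtain ⟨G, hG, hGcov⟩ := MulAction.exists_finite_transversal (Q := Q) w (hE.image Prod.fst)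
  -- The edges `wb` with `b` in the finite set `B` represent all crossed edges at `w`.
  let B : Set W := {b | T.Adj w b ∧ ∃ k ∈ G, ∃ e ∈ E, b = k • e.2}
  have hB : B.Finite := by
    refine ((hG.prod hE).image fun x : Q × (W × W) => x.1 • x.2.2).subset ?_
    rintro _ ⟨-, k, hk, e, he, rfl⟩
    exact ⟨(k, e), ⟨hk, he⟩, rfl⟩
  have hK : ∀ b : W, ∃ (K : Set V) (M : Set V), T.Adj w b → X.GeodConvex K ∧ K.Nonempty ∧
      (∀ p, CubeComplex.IsCrossing Q X T V₀ w b p → p ∈ K) ∧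
      M.Finite ∧ ∀ p ∈ K, ∃ s ∈ MulAction.stabilizer Q w, s • p ∈ M := by
    intro b
    by_cases hb : T.Adj w b
    · obtain ⟨K, h₁, h₂, h₃, M, h₄, h₅⟩ :=
        hX.exists_convex_crossing hV₀ hE (hcross b) (hedge w b hb)
      exact ⟨K, M, fun _ => ⟨h₁, h₂, h₃, h₄, h₅⟩⟩
    · exact ⟨∅, ∅, fun h => absurd h hb⟩
  choose K M hKM using hK
  refine (hX.isConvexCocompact_iff _).2
    ⟨X.hull (MulAction.orbit (MulAction.stabilizer Q w) (g₀⁻¹ • v)),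
      ⟨_, CubeComplex.subset_hull _ (MulAction.mem_orbit_self _)⟩,
      CubeComplex.geodConvex_hull _, fun h hh x hx => hX.smul_mem_hull_orbit _ _ hh hx,
      V₀ ∪ ⋃ b ∈ B, M b, hV₀.union (hB.biUnion fun b hb => (hKM b hb.1).2.2.2.1), ?_⟩
  intro p hp
  obtain ⟨g, hg, -⟩ := hcov p p (.inr rfl)
  by_cases hgw : g • w = w
  · exact ⟨g⁻¹, Subgroup.inv_mem _ hgw, .inl hg⟩
  obtain ⟨b, hb, hgb⟩ := hT.isTree.exists_notMem_side hgw
  obtain ⟨q, hq, -⟩ := hX.exists_isCrossing (T := T) (w := w) (b := b) hcov (g := 1)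
    (by simpa using hx₀) (by simpa using SimpleGraph.self_mem_side w b) hg hgb
  obtain ⟨k, -, hkE⟩ := hcross b q hq
  obtain ⟨s, hs, k', hk', rfl⟩ := hGcov k ⟨_, hkE, rfl⟩
  -- Translating by `s⁻¹`, the edge `wb` becomes one of the representatives.
  have hsw : s⁻¹ • w = w := by
    rw [inv_smul_eq_iff]
    exact hs.symm
  have hbB : s⁻¹ • b ∈ B := by
    refine ⟨?_, k', hk', _, hkE, ?_⟩
    · have := hT.smul_adj s⁻¹ w b hb
      rwa [hsw] at this
    · simp [← mul_smul]
  obtain ⟨h₁, h₂, h₃, -, h₅⟩ := hKM _ hbB.1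
  have hpK : s⁻¹ • p ∈ K (s⁻¹ • b) := by
    refine hX.mem_of_mem_hull hcov hx₀ h₁ h₂ h₃
      (hX.smul_mem_hull_orbit _ _ (Subgroup.inv_mem _ hs) hp) (g := s⁻¹ * g) ?_ ?_
    · simpa [← mul_smul] using hg
    · have := (SimpleGraph.smul_mem_side_iff hT.smul_adj s⁻¹ (a := w) (b := b)).not.2 hgb
      rwa [hsw, ← mul_smul] at this
  obtain ⟨r, hr, hrM⟩ := h₅ _ hpK
  exact ⟨r * s⁻¹, Subgroup.mul_mem _ hr (Subgroup.inv_mem _ hs),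
    .inr (Set.mem_biUnion hbB (by rwa [mul_smul]))⟩
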